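/- Fix $n$ Boolean variables $x_1,\dots,x_n$. The fully polarized random 2-CNF formula $\Phi_m(n,2,0)=C_1\wedge\dots\wedge C_m$ consists of $m$ independent random clauses: for each clause, one picks an ordered pair $(v_1,v_2)$ of distinct indices in $\{1,\dots,n\}$ uniformly at random, and an independent fair coin decides whether the clause is $x_{v_1}\vee x_{v_2}$ or $\neg x_{v_1}\vee\neg x_{v_2}$. The implication digraph of a 2-CNF formula has the $2n$ literals $x_i,\neg x_i$ as vertices, and each clause $y\vee z$ contributes the two arcs $\neg y\Rightarrow z$ and $\neg z\Rightarrow y$. A bicycle is a directed cycle that contains both $x_i$ and $\neg x_i$ for some $i$. A unicycle is a bicycle of even length in which exactly one variable $x$ is repeated, this variable occurring precisely twice, once as $x$ and once as $\neg x$, at diametrically opposed points of the cycle. **Proposition.** Let $\varepsilon=\varepsilon(n)$ satisfy $0<\varepsilon(n)<\tfrac12$ for all large $n$ and $n^{-0.1}(\ln n)^{0.9}=o(\varepsilon(n))$ as $n\to\infty$, and let $m=m(n)$ be integers with $m(n)>(1+\varepsilon(n))\,n$ for all large $n$. Then, as $n\to\infty$, the probability that the implication digraph of $\Phi_{m(n)}(n,2,0)$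 contains a unicycle tends to $1$. Consequently the probability that $\Phi_{m(n)}(n,2,0)$ is unsatisfiable tends to $1$ as well. -/

import Mathlib

open Filter Topology Asymptotics MeasureTheory ProbabilityTheory

namespace PolarizedSAT

/-- A literal on the variables `x_i`, `i : Fin n`: the pair `(i, true)` is the pure literal `x_i`,
the pair `(i, false)` is the negated literal `¬ x_i`. -/
abbrev Literal (n : ℕ) : Type := Fin n × Bool

/-- Negation of a literal. -/
def Literal.neg {n : ℕ} (z : Literal n) : Literal n := (z.1, !z.2)

/-- A clause is identified with the set of literals of which it is the disjunction. -/
abbrev Clause (n : ℕ) : Type := Finset (Literal n)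

/-- A formula in conjunctive normal form with `m` clauses `F 0, …, F (m - 1)`. -/
abbrev Formula (n m : ℕ) : Type := Fin m → Clause n

/-- Some truth assignment makes at least one literal of every clause true. -/
def Formula.Satisfiable {n m : ℕ} (F : Formula n m) : Prop :=
  ∃ σ : Fin n → Bool, ∀ i, ∃ z ∈ F i, σ z.1 = z.2

/-! ### The polarized random model

The sign `+1` is encoded by `true` and the sign `-1` by `false`. -/

/-- The random choices `(K, B, P)` made for one clause: the tuple `K` of variables, the sign `B` of
the clause, and the signs `P_j` of its places. -/
abbrev Seed (n k : ℕ) : Type := (Fin k → Fin n) × Bool × (Fin k → Bool)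

/-- The clause `z_1 ∨ … ∨ z_k`, where `z_j` is the pure literal on the variable `K_j` if
`B P_j = 1`, that is if `B = P_j`, and the negated literal on it otherwise. -/
def Seed.clause {n k : ℕ} (s : Seed n k) : Clause n :=
  Finset.univ.image fun j => (s.1 j, s.2.1 == s.2.2 j)

/-- The law of the choices for one clause: `K` is uniform among the `k`-tuples of distinct indices,
`B` is a fair sign, every `P_j` is `+1` with probability `p` and `-1` with probability `1 - p`, and
all of these are independent. -/
noncomputable def seedLaw (n k : ℕ) (p : unitInterval) : Measure (Seed n k) :=
  (uniformOn {v : Fin k → Fin n | Function.Injective v}).prod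
    ((uniformOn (Set.univ : Set Bool)).prod
      (Measure.pi fun _ : Fin k => bernoulliMeasure true false p))

/-- The law of the choices for `m` independent clauses. -/
noncomputable def modelLaw (n k : ℕ) (p : unitInterval) (m : ℕ) : Measure (Fin m → Seed n k) :=
  Measure.pi fun _ : Fin m => seedLaw n k p

/-- The random formula `Φ_m(n, k, p)`, as a function of the random choices. -/
def randomFormula {n k m : ℕ} (ω : Fin m → Seed n k) : Formula n m :=
  fun i => (ω i).clause

/-- The probability that the `p`-polarized random `k`-CNF formula with `m` clauses on `n` variables
has the property `Q`. -/
noncomputable def prob (n k : ℕ) (p : unitInterval) (m : ℕ) (Q : Formula n m → Prop) : ℝ :=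
  (modelLaw n k p m).real {ω | Q (randomFormula ω)}

/-! ### The digraph of implications -/

/-- The digraph of implications of a 2-CNF formula: its vertices are the `2n` literals, and each
clause `y ∨ z` gives the arcs `¬ y ⇒ z` and `¬ z ⇒ y`. -/
def implicationDigraph {n m : ℕ} (F : Formula n m) : Digraph (Literal n) where
  Adj a b := ∃ i, F i = {a.neg, b}

/-- `c 0 → c 1 → … → c (L - 1) → c 0` is a directed cycle of length `L` in `G`, without repeated
vertices. The permutation `finRotate L` sends `i` to `i + 1` modulo `L`. -/
structure IsDirectedCycle {V : Type*} (G : Digraph V) {L : ℕ} (c : Fin L → V) : Prop where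
  pos : 0 < L
  injective : Function.Injective c
  adj : ∀ i, G.Adj (c i) (c (finRotate L i))

/-- A bicycle: a directed cycle that contains both literals `x`, `¬ x` on some variable. -/
structure IsBicycle {n : ℕ} (G : Digraph (Literal n)) {L : ℕ} (c : Fin L → Literal n) : Prop where
  isDirectedCycle : IsDirectedCycle G c
  exists_conflict : ∃ x : Fin n, (∃ i, c i = (x, true)) ∧ ∃ j, c j = (x, false)

/-- A unicycle: a bicycle of even length with a unique repeated variable `x`, and this variable
occurs precisely twice, as `x` and as `¬ x`, at diametrically opposed points of the cycle. -/
structure IsUnicycle {n : ℕ} (G : Digraph (Literal n)) {L : ℕ} (c : Fin L → Literal n) : Prop where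
  isBicycle : IsBicycle G c
  even_length : Even L
  exists_repeated : ∃ (x : Fin n) (i j : Fin L),
    c i = (x, true) ∧ c j = (x, false) ∧ (i.val + L / 2) % L = j.val ∧
    (∀ a, (c a).1 = x → a = i ∨ a = j) ∧
    ∀ a b, a ≠ b → (c a).1 = (c b).1 → (c a).1 = x

/-- The digraph contains a unicycle. -/
def HasUnicycle {n : ℕ} (G : Digraph (Literal n)) : Prop :=
  ∃ (L : ℕ) (c : Fin L → Literal n), IsUnicycle G c

end PolarizedSAT

/-!
A unicycle of length `2 (r + 1)` is made of two loops of `r + 1` steps through the repeated variable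
`x`: it runs from `x` to `¬ x` along one of them and back along the other, and since all clauses are
polarized the signs alternate, so that `r` has to be even. The number of ways to find such a pair of
loops among the clauses is treated by the second moment method, in the form
`(𝔼 N) ^ 2 ≤ ℙ (N ≠ 0) * 𝔼 (N ^ 2)`.

Given one pair of loops, the expected number of pairs of loops is at most a sum over `x` of products
of two weighted counts of closed walks at `x`, in which a step has weight `θ ≈ m / n ^ 2`, plus `1`
if it runs along the given loops. Alternation of signs forces a walk on a given loop to keep its
direction. Hence there is a bounded weight on the variables that grows at most by the rate
`1 + 1 / (r + 1) < n θ` along the given loops, and it shows that the given loops change the growth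
rate `n θ ≥ 1 + ε` of the number of walks only slightly. With `δ = (r + 1) ^ 2 / (ε n)`, the number
of closed walks at `x` is at most `1 / n` times `(1 + O(δ)) (n θ) ^ (r + 1)` if `x` is not on the
given loops, and `O(δ) (n θ) ^ (r + 1)` if it is, where `(1 + ε) ^ (r + 1) ≥ n` makes the walk once
around a given loop negligible. For `r` of order `log n / ε`, the relative error
`r n δ ^ 2 = r ^ 5 / (ε ^ 2 n)` is of order `(log n) ^ 5 / (ε ^ 7 n)`.
-/

namespace PolarizedSAT

section SecondMoment

variable {Ω ι : Type*} [MeasurableSpace Ω] {μ : Measure Ω} [IsFiniteMeasure μ]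

theorem sq_integral_le_measureReal_mul_integral_sq {f : Ω → ℝ} {U : Set Ω} (hf : MemLp f 2 μ)
    (hU : MeasurableSet U) (hfU : Function.support f ⊆ U) :
    (∫ ω, f ω ∂μ) ^ 2 ≤ μ.real U * ∫ ω, f ω ^ 2 ∂μ := by
  have hquad (c : ℝ) : 0 ≤ (∫ ω, f ω ^ 2 ∂μ) * (c * c) + (-2 * ∫ ω, f ω ∂μ) * c + μ.real U := by
    have hexpand (ω : Ω) : (U.indicator 1 ω - c * f ω) ^ 2 =
        c * c * f ω ^ 2 + -2 * c * f ω + U.indicator 1 ω := by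
      by_cases hω : ω ∈ U
      · simp only [Set.indicator_of_mem hω, Pi.one_apply]
        ring
      · simp only [Set.indicator_of_notMem hω, Function.notMem_support.1 fun h => hω (hfU h)]
        ring
    have hf_int : Integrable f μ := hf.integrable one_le_two
    have hU_int : Integrable (U.indicator (1 : Ω → ℝ)) μ := (integrable_const 1).indicator hU
    have hnonneg : 0 ≤ ∫ ω, (U.indicator 1 ω - c * f ω) ^ 2 ∂μ :=
      integral_nonneg fun _ => sq_nonneg _
    simp only [hexpand] at hnonneg
    have hsq_int : Integrable (fun ω => c * c * f ω ^ 2) μ := hf.integrable_sq.const_mul _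
    have hlin_int : Integrable (fun ω => -2 * c * f ω) μ := hf_int.const_mul _
    rw [integral_add (by exact hsq_int.add hlin_int) hU_int, integral_add hsq_int hlin_int,
      integral_const_mul, integral_const_mul, integral_indicator_one hU] at hnonneg
    linarith
  have hdiscrim := discrim_le_zero hquad
  rw [discrim] at hdiscrim
  linarith

variable [Fintype ι] {B : ι → Set Ω}

theorem sq_sum_measureReal_le (hB : ∀ i, MeasurableSet (B i)) :
    (∑ i, μ.real (B i)) ^ 2 ≤ μ.real (⋃ i, B i) * ∑ i, ∑ j, μ.real (B i ∩ B j) := by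
  set f : Ω → ℝ := fun ω => ∑ i, (B i).indicator 1 ω
  have hint {A : Set Ω} (hA : MeasurableSet A) : Integrable (A.indicator (1 : Ω → ℝ)) μ :=
    (integrable_const 1).indicator hA
  have hf : MemLp f 2 μ := memLp_finsetSum _ fun i _ =>
    memLp_indicator_const 2 (hB i) (1 : ℝ) (.inr (measure_ne_top μ _))
  have hf_support : Function.support f ⊆ ⋃ i, B i := by
    refine Function.support_subset_iff'.2 fun ω hω => Finset.sum_eq_zero fun i _ => ?_
    exact Set.indicator_of_notMem (fun hi => hω (Set.mem_iUnion.2 ⟨i, hi⟩)) _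
  have hf_integral : ∫ ω, f ω ∂μ = ∑ i, μ.real (B i) := by
    rw [integral_finsetSum _ fun i _ => hint (hB i)]
    exact Finset.sum_congr rfl fun i _ => integral_indicator_one (hB i)
  have hf_sq (ω : Ω) : f ω ^ 2 = ∑ i, ∑ j, (B i ∩ B j).indicator 1 ω := by
    simp only [f, sq, Finset.sum_mul_sum, Set.inter_indicator_one, Pi.mul_apply]
  have hf_sq_integral : ∫ ω, f ω ^ 2 ∂μ = ∑ i, ∑ j, μ.real (B i ∩ B j) := by
    have hinter (i j : ι) := (hB i).inter (hB j)
    simp only [hf_sq]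
    rw [integral_finsetSum _ fun i _ => integrable_finsetSum _ fun j _ => hint (hinter i j)]
    refine Finset.sum_congr rfl fun i _ => ?_
    rw [integral_finsetSum _ fun j _ => hint (hinter i j)]
    exact Finset.sum_congr rfl fun j _ => integral_indicator_one (hinter i j)
  rw [← hf_integral, ← hf_sq_integral]
  exact sq_integral_le_measureReal_mul_integral_sq hf (MeasurableSet.iUnion hB) hf_support

theorem sum_measureReal_le_measureReal_iUnion_mul {C : ℝ} (hB : ∀ i, MeasurableSet (B i))
    (hC : ∀ i, ∑ j, μ.real (B i ∩ B j) ≤ C * μ.real (B i)) :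
    ∑ i, μ.real (B i) ≤ μ.real (⋃ i, B i) * C := by
  obtain hzero | hpos := (Finset.sum_nonneg fun i _ =>
    measureReal_nonneg (μ := μ) (s := B i)).eq_or_lt (b := ∑ i, μ.real (B i))
  · have hunion : μ.real (⋃ i, B i) = 0 :=
      le_antisymm ((measureReal_iUnion_fintype_le B).trans_eq hzero.symm) measureReal_nonneg
    rw [← hzero, hunion, zero_mul]
  · have hsum : ∑ i, ∑ j, μ.real (B i ∩ B j) ≤ C * ∑ i, μ.real (B i) := by
      rw [Finset.mul_sum]
      exact Finset.sum_le_sum fun i _ => hC i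
    refine le_of_mul_le_mul_right ?_ hpos
    calc (∑ i, μ.real (B i)) * ∑ i, μ.real (B i)
        ≤ μ.real (⋃ i, B i) * ∑ i, ∑ j, μ.real (B i ∩ B j) :=
          (sq _).symm.trans_le (sq_sum_measureReal_le hB)
      _ ≤ μ.real (⋃ i, B i) * (C * ∑ i, μ.real (B i)) :=
          mul_le_mul_of_nonneg_left hsum measureReal_nonneg
      _ = μ.real (⋃ i, B i) * C * ∑ i, μ.real (B i) := (mul_assoc _ _ _).symm

end SecondMoment

theorem sum_embedding_le_sum {α β : Type*} [Fintype α] [Fintype β] [Fintype (α ↪ β)] [DecidableEq α]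
    {F : (α → β) → ℝ} (hF : ∀ f, 0 ≤ F f) : ∑ φ : α ↪ β, F φ ≤ ∑ f, F f := by
  let coe : (α ↪ β) ↪ (α → β) := ⟨fun φ => φ, DFunLike.coe_injective⟩
  calc ∑ φ : α ↪ β, F φ = ∑ f ∈ Finset.univ.map coe, F f := (Finset.sum_map _ coe F).symm
    _ ≤ ∑ f, F f :=
      Finset.sum_le_sum_of_subset_of_nonneg (Finset.subset_univ _) fun f _ _ => hF f

section Occurrence

variable {S E β κ : Type*} {X : S → E}

/-- The event that the coordinates selected by `φ` of a point `ω` of a product space realize the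
pattern `e`, one value for each coordinate, when they are read through `X`. In the application `X`
is the clause built from the random choices made for it. -/
def occurrence (X : S → E) (φ : β ↪ κ) (e : β → E) : Set (κ → S) :=
  {ω | ∀ j, X (ω (φ j)) = e j}

theorem occurrence_inter_eq_empty {φ φ' : β ↪ κ} {e e' : β → E} {i j : β} (hφ : φ i = φ' j)
    (he : e i ≠ e' j) : occurrence X φ e ∩ occurrence X φ' e' = ∅ :=
  Set.eq_empty_of_forall_notMem fun ω hω => he <| by rw [← hω.1 i, ← hω.2 j, hφ]

variable [MeasurableSpace S] {ν : Measure S} {q : ℝ}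

theorem measurableSet_occurrence [Countable β] [MeasurableSpace E] [MeasurableSingletonClass E]
    (hX : Measurable X) (φ : β ↪ κ) (e : β → E) : MeasurableSet (occurrence X φ e) :=
  measurableSet_setOfPred.2 <| .forall fun j => measurableSet_setOfPred.1 <|
    (hX.comp (measurable_pi_apply (φ j))) (measurableSet_singleton (e j))

variable [Fintype β] [Fintype κ] [IsProbabilityMeasure ν]

theorem measureReal_pi_forall_mem (φ : β ↪ κ) (A : β → Set S) :
    (Measure.pi fun _ : κ => ν).real {ω | ∀ j, ω (φ j) ∈ A j} = ∏ j, ν.real (A j) := by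
  have hbox : {ω : κ → S | ∀ j, ω (φ j) ∈ A j} =
      Set.univ.pi (Function.extend φ A fun _ => Set.univ) := by
    ext ω
    simp only [Set.mem_ofPred_eq, Set.mem_univ_pi]
    refine ⟨fun h a => ?_, fun h j => φ.injective.extend_apply A _ j ▸ h (φ j)⟩
    by_cases ha : ∃ j, φ j = a
    · obtain ⟨j, rfl⟩ := ha
      exact (φ.injective.extend_apply A _ j).symm ▸ h j
    · exact Function.extend_apply' A _ a ha ▸ Set.mem_univ _
  rw [hbox, measureReal_def, Measure.pi_pi, ENNReal.toReal_prod]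
  refine (Fintype.prod_of_injective φ φ.injective _ _ (fun a ha => ?_) fun j => ?_).symm
  · rw [Function.extend_apply' A _ a ha, measure_univ, ENNReal.toReal_one]
  · rw [φ.injective.extend_apply, measureReal_def]

theorem measureReal_occurrence (φ : β ↪ κ) {e : β → E} (he : ∀ j, ν.real (X ⁻¹' {e j}) = q) :
    (Measure.pi fun _ : κ => ν).real (occurrence X φ e) = q ^ Fintype.card β := by
  refine (measureReal_pi_forall_mem φ fun j => X ⁻¹' {e j}).trans ?_
  rw [Finset.prod_congr rfl fun j _ => he j, Finset.prod_const, Finset.card_univ]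

theorem measureReal_occurrence_inter_le (φ φ' : β ↪ κ) {e e' : β → E}
    (he : ∀ j, ν.real (X ⁻¹' {e j}) = q) (he' : ∀ j, ν.real (X ⁻¹' {e' j}) = q) (hq : 0 ≤ q) :
    (Measure.pi fun _ : κ => ν).real (occurrence X φ e ∩ occurrence X φ' e') ≤
      q ^ Fintype.card β *
        ∏ j, (q + (Set.range fun i => (φ i, e i)).indicator 1 (φ' j, e' j)) := by
  classical
  have hindicator (j : β) :
      0 ≤ (Set.range fun i => (φ i, e i)).indicator (1 : κ × E → ℝ) (φ' j, e' j) :=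
    Set.indicator_nonneg (fun _ _ => zero_le_one) _
  by_cases hcompatible : ∀ i j, φ i = φ' j → e i = e' j
  · let J := {j // φ' j ∉ Set.range φ}
    let χ : β ⊕ J ↪ κ := ⟨Sum.elim φ fun j => φ' j.1, φ.injective.sumElim
      (φ'.injective.comp Subtype.val_injective) fun i j h => j.2 ⟨i, h⟩⟩
    have hχ : ∀ j, ν.real (X ⁻¹' {Sum.elim e (fun j : J => e' j.1) j}) = q :=
      Sum.rec he fun j => he' j.1
    calc _ ≤ (Measure.pi fun _ : κ => ν).real (occurrence X χ (Sum.elim e fun j : J => e' j.1)) :=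
          measureReal_mono fun ω hω => Sum.rec hω.1 fun j => hω.2 j.1
      _ = q ^ Fintype.card β * ∏ j, if φ' j ∉ Set.range φ then q else 1 := by
          rw [measureReal_occurrence χ hχ, Fintype.card_sum, pow_add, Finset.prod_ite,
            Finset.prod_const_one, mul_one, Finset.prod_const, Fintype.card_subtype]
      _ ≤ _ := by
          refine mul_le_mul_of_nonneg_left (Finset.prod_le_prod (fun j _ => ?_) fun j _ => ?_)
            (pow_nonneg hq _)
          · split_ifs <;> positivity
          · split_ifs with hj
            · obtain ⟨i, hi⟩ := hj
              rw [Set.indicator_of_mem (Set.mem_range.2 ⟨i, Prod.ext hi (hcompatible i j hi)⟩),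
                Pi.one_apply]
              exact le_add_of_nonneg_left hq
            · exact le_add_of_nonneg_right (hindicator j)
  · push Not at hcompatible
    obtain ⟨i, j, hφ, he_ne⟩ := hcompatible
    rw [occurrence_inter_eq_empty hφ he_ne, measureReal_empty]
    exact mul_nonneg (pow_nonneg hq _) (Finset.prod_nonneg fun j _ => add_nonneg hq (hindicator j))

theorem sum_measureReal_occurrence_inter_le [Fintype (β ↪ κ)] (φ : β ↪ κ) {e e' : β → E}
    (he_inj : Function.Injective e) (he : ∀ j, ν.real (X ⁻¹' {e j}) = q)
    (he' : ∀ j, ν.real (X ⁻¹' {e' j}) = q) (hq : 0 ≤ q) :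
    ∑ φ' : β ↪ κ, (Measure.pi fun _ : κ => ν).real (occurrence X φ e ∩ occurrence X φ' e') ≤
      q ^ Fintype.card β *
        ∏ j, (Fintype.card κ * q + (Set.range e).indicator 1 (e' j)) := by
  classical
  set w : κ → β → ℝ := fun a j => q + (Set.range fun i => (φ i, e i)).indicator 1 (a, e' j)
  have hw (a : κ) (j : β) : 0 ≤ w a j :=
    add_nonneg hq (Set.indicator_nonneg (fun _ _ => zero_le_one) _)
  have hw_sum (j : β) : ∑ a, w a j = Fintype.card κ * q + (Set.range e).indicator 1 (e' j) := by
    rw [Finset.sum_add_distrib, Finset.sum_const, Finset.card_univ, nsmul_eq_mul]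
    congr 1
    by_cases hj : e' j ∈ Set.range e
    · obtain ⟨i, hi⟩ := hj
      have hmem (a : κ) : (a, e' j) ∈ (Set.range fun i => (φ i, e i)) ↔ a = φ i := by
        simp [← hi, he_inj.eq_iff, eq_comm]
      rw [Set.indicator_of_mem (Set.mem_range.2 ⟨i, hi⟩), Pi.one_apply]
      simp only [Set.indicator_apply, hmem, Pi.one_apply, Finset.sum_ite_eq', Finset.mem_univ,
        if_true]
    · have hmem (a : κ) : (a, e' j) ∉ (Set.range fun i => (φ i, e i)) := by
        rintro ⟨i, hi⟩
        exact hj ⟨i, (Prod.ext_iff.1 hi).2⟩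
      simp [hj, hmem]
  calc _ ≤ ∑ φ' : β ↪ κ, q ^ Fintype.card β * ∏ j, w (φ' j) j :=
        Finset.sum_le_sum fun φ' _ => measureReal_occurrence_inter_le φ φ' he he' hq
    _ = q ^ Fintype.card β * ∑ φ' : β ↪ κ, ∏ j, w (φ' j) j := (Finset.mul_sum _ _ _).symm
    _ ≤ q ^ Fintype.card β * ∑ f : β → κ, ∏ j, w (f j) j :=
        mul_le_mul_of_nonneg_left (sum_embedding_le_sum (F := fun f => ∏ j, w (f j) j) fun f =>
          Finset.prod_nonneg fun j _ => hw _ _) (pow_nonneg hq _)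
    _ = _ := by
        rw [← Finset.prod_congr rfl fun j _ => hw_sum j, Fintype.prod_sum]

theorem card_mul_le_measureReal_exists_occurrence_mul [MeasurableSpace E]
    [MeasurableSingletonClass E] {τ : Type*} [Fintype τ] {e : τ → β → E} {C : ℝ}
    (hX : Measurable X) (he_inj : ∀ t, Function.Injective (e t))
    (he : ∀ t j, ν.real (X ⁻¹' {e t j}) = q) (hq : 0 ≤ q)
    (hC : ∀ t, ∑ t', ∏ j, (Fintype.card κ * q + (Set.range (e t)).indicator 1 (e t' j)) ≤ C) :
    Fintype.card τ * (Fintype.card κ).descFactorial (Fintype.card β) * q ^ Fintype.card β ≤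
      (Measure.pi fun _ : κ => ν).real {ω | ∃ t, ∃ φ : β ↪ κ, ω ∈ occurrence X φ (e t)} * C := by
  classical
  set μ := Measure.pi fun _ : κ => ν
  let B : τ × (β ↪ κ) → Set (κ → S) := fun x => occurrence X x.2 (e x.1)
  have hB (x : τ × (β ↪ κ)) : μ.real (B x) = q ^ Fintype.card β :=
    measureReal_occurrence x.2 (he x.1)
  have hB_inter (x : τ × (β ↪ κ)) : ∑ y, μ.real (B x ∩ B y) ≤ C * μ.real (B x) := by
    rw [Fintype.sum_prod_type, hB, mul_comm C]
    refine (Finset.sum_le_sum fun t' _ => sum_measureReal_occurrence_inter_le x.2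
      (he_inj x.1) (he x.1) (he t') hq).trans ?_
    rw [← Finset.mul_sum]
    exact mul_le_mul_of_nonneg_left (hC x.1) (pow_nonneg hq _)
  have hunion : ⋃ x, B x = {ω | ∃ t, ∃ φ : β ↪ κ, ω ∈ occurrence X φ (e t)} := by
    ext ω
    simp only [Set.mem_iUnion, Prod.exists, Set.mem_ofPred_eq, B]
  have hB_card : ∑ x, μ.real (B x) =
      Fintype.card τ * (Fintype.card κ).descFactorial (Fintype.card β) * q ^ Fintype.card β := by
    rw [Finset.sum_congr rfl fun x _ => hB x, Finset.sum_const, Finset.card_univ,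
      Fintype.card_prod, Fintype.card_embedding_eq, nsmul_eq_mul, Nat.cast_mul]
  rw [← hunion, ← hB_card]
  exact sum_measureReal_le_measureReal_iUnion_mul
    (fun x => measurableSet_occurrence hX x.2 (e x.1)) hB_inter

end Occurrence

/-- The sign after `p` steps of a walk with alternating signs that starts with the sign `s`. -/
def alternate (s : Bool) (p : ℕ) : Bool := s ^^ p.bodd

theorem alternate_zero (s : Bool) : alternate s 0 = s := by simp [alternate]

theorem alternate_succ (s : Bool) (p : ℕ) : alternate s (p + 1) = !alternate s p := by
  simp [alternate]

theorem alternate_not (s : Bool) (p : ℕ) : alternate (!s) p = alternate s (p + 1) := by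
  simp [alternate]

theorem alternate_of_even {p : ℕ} (hp : Even p) (s : Bool) : alternate s p = s := by
  obtain ⟨k, rfl⟩ := hp
  simp [alternate]

/-- The sequence `a, y 0, …, y (r - 1), b, b, …`, which runs from `a` to `b` through `y`. -/
def path {α : Type*} {r : ℕ} (a : α) (y : Fin r → α) (b : α) : ℕ → α
  | 0 => a
  | p + 1 => if h : p < r then y ⟨p, h⟩ else b

theorem path_cons_succ {α : Type*} {r : ℕ} (a v : α) (y : Fin r → α) (b : α) (p : ℕ) :
    path a (Fin.cons v y : Fin (r + 1) → α) b (p + 1) = path v y b p := by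
  cases p with
  | zero => simp [path]
  | succ p =>
    simp only [path, Nat.add_lt_add_iff_right]
    split_ifs with hp
    · exact Fin.cons_succ (α := fun _ => α) v y ⟨p, hp⟩
    · rfl

section Transfer

variable {α : Type*} [Fintype α]

/-- The transfer operator of walks with alternating signs on `α`, where `w s u v` is the weight of
a step from `u` to `v` that arrives with the sign `s`. -/
def transfer (w : Bool → α → α → ℝ) : Module.End ℝ (α → Bool → ℝ) where
  toFun f u s := ∑ v, w (!s) u v * f v (!s)
  map_add' f g := by
    ext u s
    simp only [Pi.add_apply, mul_add, Finset.sum_add_distrib]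
  map_smul' c f := by
    ext u s
    simp only [Pi.smul_apply, smul_eq_mul, mul_left_comm, RingHom.id_apply, Finset.mul_sum]

theorem transfer_apply (w : Bool → α → α → ℝ) (f : α → Bool → ℝ) (u : α) (s : Bool) :
    transfer w f u s = ∑ v, w (!s) u v * f v (!s) := rfl

theorem monotone_transfer {w : Bool → α → α → ℝ} (hw : 0 ≤ w) : Monotone (transfer w) :=
  fun _ _ h _ s => Finset.sum_le_sum fun v _ => mul_le_mul_of_nonneg_left (h v (!s)) (hw _ _ _)

theorem transfer_const_add (θ : ℝ) (A : Bool → α → α → ℝ) (f : α → Bool → ℝ) (u : α) (s : Bool) :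
    transfer (fun s u v => θ + A s u v) f u s = θ * ∑ v, f v (!s) + transfer A f u s := by
  simp only [transfer_apply, add_mul, Finset.sum_add_distrib, Finset.mul_sum]

theorem sum_prod_path [DecidableEq α] (w : Bool → α → α → ℝ) (b : α) (r : ℕ) (a : α) (s : Bool) :
    ∑ y : Fin r → α, ∏ p ∈ Finset.range (r + 1),
      w (alternate s (p + 1)) (path a y b p) (path a y b (p + 1)) =
      (transfer w ^ (r + 1)) (Pi.single b 1) a s := by
  induction r generalizing a s with
  | zero => simp [transfer_apply, path, alternate, Pi.single_apply, apply_ite, ite_apply]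
  | succ r ih =>
    rw [pow_succ', Module.End.mul_apply, transfer_apply,
      ← (Fin.consEquiv fun _ : Fin (r + 1) => α).sum_comp, Fintype.sum_prod_type]
    refine Finset.sum_congr rfl fun v _ => ?_
    rw [← ih, Finset.mul_sum]
    refine Finset.sum_congr rfl fun y _ => ?_
    rw [Finset.prod_range_succ', mul_comm]
    congr 1
    · simp [Fin.consEquiv, path, alternate]
    · exact Finset.prod_congr rfl fun p _ => by
        simp only [Fin.consEquiv, Equiv.coe_fn_mk, path_cons_succ, alternate_not]

end Transfer

section PositiveOperator

variable {𝕜 E : Type*} [CommRing 𝕜] [PartialOrder 𝕜] [IsOrderedRing 𝕜] [AddCommGroup E]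
  [PartialOrder E] [Module 𝕜 E] [PosSMulMono 𝕜 E] {T : Module.End 𝕜 E} {f g ψ : E} {c ρ γ : 𝕜}

theorem pow_apply_le_smul (hT : Monotone T) (hγ : 0 ≤ γ) (hg : T g ≤ γ • g) (j : ℕ) :
    (T ^ j) g ≤ γ ^ j • g := by
  induction j with
  | zero => simp
  | succ j ih =>
    calc (T ^ (j + 1)) g = T ((T ^ j) g) := by rw [pow_succ', Module.End.mul_apply]
      _ ≤ T (γ ^ j • g) := hT ih
      _ = γ ^ j • T g := map_smul _ _ _
      _ ≤ γ ^ j • γ • g := smul_le_smul_of_nonneg_left hg (pow_nonneg hγ j)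
      _ = γ ^ (j + 1) • g := by rw [smul_smul, pow_succ]

theorem pow_succ_apply_le_smul_add_smul [IsOrderedAddMonoid E] [SMulPosMono 𝕜 E] (hT : Monotone T)
    (hψ : T ψ ≤ ρ • ψ + c • g) (hg : T g ≤ γ • g) (hg_nonneg : 0 ≤ g) (hc : 0 ≤ c) (hρ : 0 ≤ ρ)
    (hργ : ρ ≤ γ) (j : ℕ) :
    (T ^ (j + 1)) ψ ≤ ρ ^ (j + 1) • ψ + ((j + 1) * c * γ ^ j) • g := by
  have hγ : 0 ≤ γ := hρ.trans hργ
  induction j with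
  | zero => simpa using hψ
  | succ j ih =>
    have hcoeff : 0 ≤ (j + 1) * c * γ ^ j :=
      mul_nonneg (mul_nonneg (add_nonneg j.cast_nonneg zero_le_one) hc) (pow_nonneg hγ j)
    calc (T ^ (j + 1 + 1)) ψ = T ((T ^ (j + 1)) ψ) := by rw [pow_succ', Module.End.mul_apply]
      _ ≤ ρ ^ (j + 1) • T ψ + ((j + 1) * c * γ ^ j) • T g := by
          rw [← map_smul, ← map_smul, ← map_add]
          exact hT ih
      _ ≤ ρ ^ (j + 1) • (ρ • ψ + c • g) + ((j + 1) * c * γ ^ j) • γ • g :=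
          add_le_add (smul_le_smul_of_nonneg_left hψ (pow_nonneg hρ _))
            (smul_le_smul_of_nonneg_left hg hcoeff)
      _ = ρ ^ (j + 1 + 1) • ψ + (ρ ^ (j + 1) * c + (j + 1) * c * γ ^ (j + 1)) • g := by module
      _ ≤ ρ ^ (j + 1 + 1) • ψ + (γ ^ (j + 1) * c + (j + 1) * c * γ ^ (j + 1)) • g := by
          gcongr
      _ = _ := by push_cast; module

end PositiveOperator

section GrowthWeight

variable {α : Type*} [Fintype α]

/-- A weight function `ψ` that controls the number of walks with alternating signs in the random
digraph in which every arc is present with probability `θ` except that the exceptional arcs,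
counted by `A`, are present anyway: one exceptional step increases `ψ` at most by the factor `ρ`,
`2 ψ` dominates the number of exceptional steps that leave a point, and `ψ` has total mass at most
`Ψ` on every sign. -/
structure IsGrowthWeight (A : Bool → α → α → ℝ) (ψ : α → Bool → ℝ) (ρ Ψ : ℝ) : Prop where
  nonneg : 0 ≤ ψ
  transfer_le : transfer A ψ ≤ ρ • ψ
  transfer_one_le : transfer A 1 ≤ (2 : ℝ) • ψ
  sum_le : ∀ s, ∑ u, ψ u s ≤ Ψ

namespace IsGrowthWeight

variable {A : Bool → α → α → ℝ} {ψ : α → Bool → ℝ} {ρ Ψ θ K : ℝ} {b : α}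

theorem bound_nonneg (h : IsGrowthWeight A ψ ρ Ψ) : 0 ≤ Ψ :=
  (Finset.sum_nonneg fun u _ => h.nonneg u true).trans (h.sum_le true)

theorem one_le_one_add_smul (h : IsGrowthWeight A ψ ρ Ψ) (hK : 0 ≤ K) : 1 ≤ 1 + K • ψ :=
  le_add_of_nonneg_right (smul_nonneg hK h.nonneg)

theorem transfer_const_add_le (h : IsGrowthWeight A ψ ρ Ψ) (hθ : 0 ≤ θ) (hK : 0 ≤ K) :
    transfer (fun s u v => θ + A s u v) ψ ≤ ρ • ψ + (θ * Ψ) • (1 + K • ψ) := fun u s => by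
  have hsum : θ * ∑ v, ψ v (!s) ≤ θ * Ψ := mul_le_mul_of_nonneg_left (h.sum_le (!s)) hθ
  have hone : θ * Ψ * 1 ≤ θ * Ψ * (1 + K • ψ) u s :=
    mul_le_mul_of_nonneg_left (h.one_le_one_add_smul hK u s) (mul_nonneg hθ h.bound_nonneg)
  rw [transfer_const_add]
  simp only [Pi.add_apply, Pi.smul_apply, smul_eq_mul] at hone ⊢
  linarith [show transfer A ψ u s ≤ ρ * ψ u s from h.transfer_le u s]

theorem transfer_const_add_one_add_smul_le (h : IsGrowthWeight A ψ ρ Ψ) (hθ : 0 ≤ θ) (hK : 0 ≤ K)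
    (hKρ : 2 ≤ K * (Fintype.card α * θ - ρ)) :
    transfer (fun s u v => θ + A s u v) (1 + K • ψ) ≤
      (Fintype.card α * θ + θ * (K * Ψ)) • (1 + K • ψ) := fun u s => by
  have hψ : 0 ≤ ψ u s := h.nonneg u s
  have hone : transfer A 1 u s ≤ 2 * ψ u s := h.transfer_one_le u s
  have hA : K * transfer A ψ u s ≤ K * (ρ * ψ u s) :=
    mul_le_mul_of_nonneg_left (h.transfer_le u s) hK
  have hsum : θ * (K * ∑ v, ψ v (!s)) ≤ θ * (K * Ψ) := by gcongr; exact h.sum_le _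
  have hgap : 2 * ψ u s ≤ K * (Fintype.card α * θ - ρ) * ψ u s :=
    mul_le_mul_of_nonneg_right hKρ hψ
  have hrest : 0 ≤ θ * (K * Ψ) * (K * ψ u s) := by have := h.bound_nonneg; positivity
  simp only [map_add, map_smul, transfer_const_add, Pi.add_apply, Pi.smul_apply, smul_eq_mul,
    Pi.one_apply, Finset.sum_add_distrib, ← Finset.mul_sum, Finset.sum_const, Finset.card_univ,
    nsmul_eq_mul, mul_one]
  linarith

variable [DecidableEq α]

theorem pow_transfer_single_le_of_forall_eq_zero (h : IsGrowthWeight A ψ ρ Ψ) (hA : 0 ≤ A)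
    (hθ : 0 ≤ θ) (hK : 0 ≤ K) (hKρ : 2 ≤ K * (Fintype.card α * θ - ρ))
    (hb : ∀ s u, A s u b = 0) (r : ℕ) :
    (transfer (fun s u v => θ + A s u v) ^ (r + 1)) (Pi.single b 1) ≤
      (θ * (Fintype.card α * θ + θ * (K * Ψ)) ^ r) • (1 + K • ψ) := by
  have hstep : transfer (fun s u v => θ + A s u v) (Pi.single b 1) = θ • 1 := by
    ext u s
    simp [transfer_apply, Pi.single_apply, ite_apply, hb]
  have hγ : 0 ≤ Fintype.card α * θ + θ * (K * Ψ) := by have := h.bound_nonneg; positivity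
  have hmono : Monotone (transfer fun s u v => θ + A s u v) :=
    monotone_transfer fun s u v => add_nonneg hθ (hA s u v)
  rw [pow_succ, Module.End.mul_apply, hstep, map_smul, mul_smul]
  refine smul_le_smul_of_nonneg_left ?_ hθ
  calc _ ≤ (transfer (fun s u v => θ + A s u v) ^ r) (1 + K • ψ) := by
        rw [Module.End.pow_apply, Module.End.pow_apply]
        exact hmono.iterate r (h.one_le_one_add_smul hK)
    _ ≤ _ := pow_apply_le_smul hmono hγ (h.transfer_const_add_one_add_smul_le hθ hK hKρ) r

theorem pow_transfer_single_le (h : IsGrowthWeight A ψ ρ Ψ) (hA : 0 ≤ A) (hθ : 0 ≤ θ) (hK : 0 ≤ K)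
    (hρ : 0 ≤ ρ) (hKρ : 2 ≤ K * (Fintype.card α * θ - ρ)) (hb : 1 ≤ ψ b) (r : ℕ) :
    (transfer (fun s u v => θ + A s u v) ^ (r + 1)) (Pi.single b 1) ≤ ρ ^ (r + 1) • ψ +
      ((r + 1) * (θ * Ψ) * (Fintype.card α * θ + θ * (K * Ψ)) ^ r) • (1 + K • ψ) := by
  have hΨ : 0 ≤ Ψ := h.bound_nonneg
  have hsingle : Pi.single b 1 ≤ ψ := by
    intro u
    obtain rfl | hu := eq_or_ne u b
    · simpa using hb
    · simpa [hu] using h.nonneg u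
  have hργ : ρ ≤ Fintype.card α * θ + θ * (K * Ψ) := by
    have hgap : 0 < Fintype.card α * θ - ρ := pos_of_mul_pos_right (by linarith) hK
    nlinarith [mul_nonneg hθ (mul_nonneg hK hΨ)]
  have hmono : Monotone (transfer fun s u v => θ + A s u v) :=
    monotone_transfer fun s u v => add_nonneg hθ (hA s u v)
  calc _ ≤ (transfer (fun s u v => θ + A s u v) ^ (r + 1)) ψ := by
        rw [Module.End.pow_apply, Module.End.pow_apply]
        exact hmono.iterate (r + 1) hsingle
    _ ≤ _ := pow_succ_apply_le_smul_add_smul hmono (h.transfer_const_add_le hθ hK)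
        (h.transfer_const_add_one_add_smul_le hθ hK hKρ)
        (zero_le_one.trans (h.one_le_one_add_smul hK)) (mul_nonneg hθ hΨ) hρ hργ r

end IsGrowthWeight

end GrowthWeight

section Cycles

variable {V : Type*} {n m : ℕ}

theorem IsDirectedCycle.of_nat {G : Digraph V} {L : ℕ} {c : ℕ → V} (hL : 0 < L)
    (hc : ∀ i < L, ∀ j < L, c i = c j → i = j) (hadj : ∀ i < L, G.Adj (c i) (c (i + 1)))
    (hlast : c L = c 0) : IsDirectedCycle G fun i : Fin L => c i where
  pos := hL
  injective i j h := Fin.ext (hc i i.isLt j j.isLt h)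
  adj i := by
    obtain ⟨L, rfl⟩ := Nat.exists_eq_succ_of_ne_zero hL.ne'
    have hval : c (finRotate (L + 1) i) = c (i + 1) := by
      rw [coe_finRotate]
      split_ifs with hi
      · rw [hi, Fin.val_last, ← hlast]
      · rfl
    exact hval ▸ hadj i i.isLt

theorem forall_of_forall_finRotate {L : ℕ} {P : Fin L → Prop} (hP : ∀ i, P i → P (finRotate L i))
    {i : Fin L} (hi : P i) (j : Fin L) : P j := by
  obtain ⟨L, rfl⟩ := Nat.exists_eq_succ_of_ne_zero i.pos.ne'
  have hadd (k : ℕ) : P (i + Fin.ofNat (L + 1) k) := by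
    induction k with
    | zero => simpa using hi
    | succ k ih =>
      have hsucc : i + Fin.ofNat (L + 1) (k + 1) = finRotate (L + 1) (i + Fin.ofNat (L + 1) k) := by
        ext
        simp [finRotate_apply, Fin.val_add, add_assoc]
      exact hsucc ▸ hP _ ih
  simpa using hadd (j - i : Fin (L + 1))

theorem eval_of_implicationDigraph_adj {F : Formula n m} {σ : Fin n → Bool}
    (hσ : ∀ i, ∃ z ∈ F i, σ z.1 = z.2) {a b : Literal n} (hab : (implicationDigraph F).Adj a b)
    (ha : σ a.1 = a.2) : σ b.1 = b.2 := by
  obtain ⟨i, hi⟩ := hab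
  obtain ⟨z, hz, hσz⟩ := hσ i
  rw [hi, Finset.mem_insert, Finset.mem_singleton] at hz
  obtain rfl | rfl := hz
  · exact ((Bool.eq_not_self a.2).1 (ha.symm.trans hσz)).elim
  · exact hσz

theorem IsBicycle.not_satisfiable {F : Formula n m} {L : ℕ} {c : Fin L → Literal n}
    (hc : IsBicycle (implicationDigraph F) c) : ¬ F.Satisfiable := by
  rintro ⟨σ, hσ⟩
  obtain ⟨x, ⟨i, hi⟩, j, hj⟩ := hc.exists_conflict
  have hstep (k : Fin L) :
      σ (c k).1 = (c k).2 → σ (c (finRotate L k)).1 = (c (finRotate L k)).2 :=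
    eval_of_implicationDigraph_adj hσ (hc.isDirectedCycle.adj k)
  have hij (h : σ x = true) : σ x = false := by
    simpa [hj] using forall_of_forall_finRotate hstep (i := i) (by simpa [hi] using h) j
  have hji (h : σ x = false) : σ x = true := by
    simpa [hi] using forall_of_forall_finRotate hstep (i := j) (by simpa [hj] using h) i
  cases hx : σ x
  · exact Bool.false_ne_true (hx.symm.trans (hji hx))
  · exact Bool.false_ne_true ((hij hx).symm.trans hx)

theorem HasUnicycle.not_satisfiable {F : Formula n m} (h : HasUnicycle (implicationDigraph F)) :
    ¬ F.Satisfiable :=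
  let ⟨_, _, hc⟩ := h
  hc.isBicycle.not_satisfiable

end Cycles

section Loops

variable {r : ℕ}

/-- The `p`-th point of the loop `l` of a pair of loops with `r + 1` steps each. The point `none` is
common to the two loops and `some (l, i)` is the `i + 1`-st point of the loop `l`. -/
def place (l : Bool) : ℕ → Option (Bool × Fin r) := path none (fun i => some (l, i)) none

theorem place_zero (l : Bool) : place (r := r) l 0 = none := rfl

theorem place_succ (l : Bool) {p : ℕ} (hp : p < r) : place l (p + 1) = some (l, ⟨p, hp⟩) :=
  dif_pos hp

theorem place_last (l : Bool) : place (r := r) l (r + 1) = none := dif_neg r.lt_irrefl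

theorem place_eq_place {l l' : Bool} {p p' : ℕ} (hp : p ≤ r + 1) (hp' : p' ≤ r + 1)
    (h : place (r := r) l p = place l' p') :
    l = l' ∧ p = p' ∨ (p = 0 ∨ p = r + 1) ∧ (p' = 0 ∨ p' = r + 1) := by
  have hplace (l : Bool) (p : ℕ) :
      place (r := r) l (p + 1) = if h : p < r then some (l, ⟨p, h⟩) else none := rfl
  cases p <;> cases p' <;> grind [place_zero]

variable {n : ℕ}

/-- The literal at the `p`-th point of the loop `l`, when `v` assigns variables to the points of
the pair of loops. The loop `true` starts with a pure literal, the loop `false` with a negated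
one. -/
def loopLiteral (v : Option (Bool × Fin r) → Fin n) (l : Bool) (p : ℕ) : Literal n :=
  (v (place l p), alternate l p)

/-- The clause whose arcs include the step number `j.2` of the loop `j.1`. -/
def loopClause (v : Option (Bool × Fin r) → Fin n) (j : Bool × Fin (r + 1)) : Clause n :=
  {(loopLiteral v j.1 j.2).neg, loopLiteral v j.1 (j.2 + 1)}

theorem loopClause_eq (v : Option (Bool × Fin r) → Fin n) (j : Bool × Fin (r + 1)) :
    loopClause v j = {(v (place j.1 j.2), alternate j.1 (j.2 + 1)),
      (v (place j.1 (j.2 + 1)), alternate j.1 (j.2 + 1))} := by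
  rw [loopClause, loopLiteral, loopLiteral, Literal.neg, alternate_succ]

theorem place_ne_place_succ (hr : 0 < r) (l : Bool) (p : Fin (r + 1)) :
    place (r := r) l p ≠ place l (p + 1) := fun h => by
  have := place_eq_place (by omega) (by omega) h
  omega

theorem eq_of_pair_eq_pair {V : Type*} [DecidableEq V] {a b c d : V} {s t : Bool}
    (h : ({(a, s), (b, s)} : Finset (V × Bool)) = {(c, t), (d, t)}) :
    s = t ∧ (a = c ∧ b = d ∨ a = d ∧ b = c) := by
  have hset := congrArg (fun x : Finset (V × Bool) => (x : Set (V × Bool))) h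
  simp only [Finset.coe_insert, Finset.coe_singleton, Set.pair_eq_pair_iff, Prod.mk.injEq] at hset
  tauto

theorem loopClause_injective (hr : 2 ≤ r) {v : Option (Bool × Fin r) → Fin n}
    (hv : Function.Injective v) : Function.Injective (loopClause v) := by
  rintro ⟨l, p⟩ ⟨l', p'⟩ h
  rw [loopClause_eq, loopClause_eq] at h
  suffices l = l' ∧ (p : ℕ) = p' from Prod.ext this.1 (Fin.ext this.2)
  obtain ⟨hfst, hsnd⟩ | ⟨hfst, hsnd⟩ := (eq_of_pair_eq_pair h).2
  · have := place_eq_place (by omega) (by omega) (hv hfst)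
    have := place_eq_place (by omega) (by omega) (hv hsnd)
    grind
  · have := place_eq_place (by omega) (by omega) (hv hfst)
    have := place_eq_place (by omega) (by omega) (hv hsnd)
    omega

/-- The closed walk that runs first through the loop `true` and then through the loop `false`; it
has period `2 * (r + 1)`, and only the indices up to there are meaningful. -/
def loopCycle (v : Option (Bool × Fin r) → Fin n) (i : ℕ) : Literal n :=
  if i ≤ r then loopLiteral v true i else loopLiteral v false (i - (r + 1))

variable {v : Option (Bool × Fin r) → Fin n}

theorem loopCycle_zero : loopCycle v 0 = (v none, true) := by
  simp [loopCycle, loopLiteral, place_zero, alternate_zero]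

theorem loopCycle_add_one : loopCycle v (r + 1) = (v none, false) := by
  simp [loopCycle, loopLiteral, place_zero, alternate_zero]

theorem loopLiteral_last (hr : Even r) (l : Bool) : loopLiteral v l (r + 1) = (v none, !l) := by
  rw [loopLiteral, place_last, alternate_succ, alternate_of_even hr]

theorem loopCycle_two_mul (hr : Even r) : loopCycle v (2 * (r + 1)) = loopCycle v 0 := by
  rw [loopCycle_zero, loopCycle, if_neg (by omega), two_mul, Nat.add_sub_cancel,
    loopLiteral_last hr, Bool.not_false]

theorem eq_or_eq_of_loopCycle_fst_eq (hv : Function.Injective v) {i j : ℕ} (hi : i < 2 * (r + 1))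
    (hj : j < 2 * (r + 1)) (h : (loopCycle v i).1 = (loopCycle v j).1) :
    i = j ∨ (i = 0 ∨ i = r + 1) ∧ (j = 0 ∨ j = r + 1) := by
  simp only [loopCycle] at h
  split_ifs at h with hir hjr hjr <;>
  · have := place_eq_place (by omega) (by omega) (hv h)
    grind

theorem eq_of_loopCycle_eq (hv : Function.Injective v) {i j : ℕ} (hi : i < 2 * (r + 1))
    (hj : j < 2 * (r + 1)) (h : loopCycle v i = loopCycle v j) : i = j := by
  obtain hij | ⟨rfl | rfl, rfl | rfl⟩ :=
    eq_or_eq_of_loopCycle_fst_eq hv hi hj (congrArg Prod.fst h)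
  · exact hij
  · rfl
  · simp [loopCycle_zero, loopCycle_add_one] at h
  · simp [loopCycle_zero, loopCycle_add_one] at h
  · rfl

theorem adj_loopCycle (hr : Even r) {m : ℕ} {F : Formula n m}
    (hF : ∀ j, ∃ i, F i = loopClause v j) {i : ℕ} (hi : i < 2 * (r + 1)) :
    (implicationDigraph F).Adj (loopCycle v i) (loopCycle v (i + 1)) := by
  have hadj (l : Bool) {p : ℕ} (hp : p < r + 1) :
      (implicationDigraph F).Adj (loopLiteral v l p) (loopLiteral v l (p + 1)) := hF (l, ⟨p, hp⟩)
  obtain hir | rfl | hir := lt_trichotomy i r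
  · rw [loopCycle, loopCycle, if_pos hir.le, if_pos (by omega)]
    exact hadj true (by omega)
  · rw [loopCycle_add_one, loopCycle, if_pos le_rfl, ← Bool.not_true, ← loopLiteral_last hr]
    exact hadj true (by omega)
  · rw [loopCycle, loopCycle, if_neg (by omega), if_neg (by omega), Nat.sub_add_comm (by omega)]
    exact hadj false (by omega)

theorem isUnicycle_loopCycle (hr : Even r) (hv : Function.Injective v) {m : ℕ} {F : Formula n m}
    (hF : ∀ j, ∃ i, F i = loopClause v j) :
    IsUnicycle (implicationDigraph F) fun i : Fin (2 * (r + 1)) => loopCycle v i where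
  isBicycle :=
    { isDirectedCycle := .of_nat (by omega) (fun _ hi _ hj => eq_of_loopCycle_eq hv hi hj)
        (fun _ hi => adj_loopCycle hr hF hi) (loopCycle_two_mul hr)
      exists_conflict := ⟨v none, ⟨⟨0, by omega⟩, loopCycle_zero⟩,
        ⟨r + 1, by omega⟩, loopCycle_add_one⟩ }
  even_length := even_two_mul _
  exists_repeated := by
    refine ⟨v none, ⟨0, by omega⟩, ⟨r + 1, by omega⟩, loopCycle_zero, loopCycle_add_one, ?_,
      fun a ha => ?_, fun a b hab h => ?_⟩
    · rw [Nat.mul_div_cancel_left _ two_pos, zero_add, Nat.mod_eq_of_lt (by omega)]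
    · have := eq_or_eq_of_loopCycle_fst_eq hv a.isLt (Nat.succ_pos _)
        (ha.trans (congrArg Prod.fst loopCycle_zero.symm))
      exact (show (a : ℕ) = 0 ∨ (a : ℕ) = r + 1 by omega).imp Fin.ext Fin.ext
    · obtain heq | ⟨ha | ha, -⟩ := eq_or_eq_of_loopCycle_fst_eq hv a.isLt b.isLt h
      · exact absurd (Fin.ext heq) hab
      · simp only [ha, loopCycle_zero]
      · simp only [ha, loopCycle_add_one]

end Loops

section Overlaps

variable {r n : ℕ}

/-- The number, `0` or `1`, of clauses of the pair of loops `v` whose arcs include one from the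
variable `a` to the variable `b` that arrives with the sign `s`. -/
noncomputable def loopStep (v : Option (Bool × Fin r) → Fin n) (s : Bool) (a b : Fin n) : ℝ :=
  (Set.range (loopClause v)).indicator 1 {(a, s), (b, s)}

variable {v : Option (Bool × Fin r) → Fin n} {ρ : ℝ}

theorem loopStep_nonneg : 0 ≤ loopStep v := fun _ _ _ =>
  Set.indicator_nonneg (fun _ _ => zero_le_one) _

theorem loopStep_le_one (s : Bool) (a b : Fin n) : loopStep v s a b ≤ 1 :=
  Set.indicator_apply_le' (fun _ => le_rfl) fun _ => zero_le_one

theorem exists_place_of_loopStep_ne_zero {s : Bool} {a b : Fin n} (h : loopStep v s a b ≠ 0) :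
    ∃ l, ∃ p ≤ r, alternate l (p + 1) = s ∧ (v (place l p) = a ∧ v (place l (p + 1)) = b ∨
      v (place l p) = b ∧ v (place l (p + 1)) = a) := by
  obtain ⟨⟨l, p⟩, h⟩ := Set.mem_of_indicator_ne_zero h
  rw [loopClause_eq] at h
  exact ⟨l, p, p.is_le, eq_of_pair_eq_pair h⟩

theorem loopStep_of_notMem_range_left {a : Fin n} (ha : a ∉ Set.range v) (s : Bool) (b : Fin n) :
    loopStep v s a b = 0 := by
  by_contra h
  obtain ⟨l, p, -, -, ⟨rfl, -⟩ | ⟨-, rfl⟩⟩ := exists_place_of_loopStep_ne_zero h <;>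
    exact ha (Set.mem_range_self _)

theorem loopStep_of_notMem_range_right {b : Fin n} (hb : b ∉ Set.range v) (s : Bool) (a : Fin n) :
    loopStep v s a b = 0 := by
  by_contra h
  obtain ⟨l, p, -, -, ⟨-, rfl⟩ | ⟨rfl, -⟩⟩ := exists_place_of_loopStep_ne_zero h <;>
    exact hb (Set.mem_range_self _)

/-- The points of a pair of loops that a walk with alternating signs which is at the point `o` with
the sign `s` can reach by one step along the loops. Away from the common point, the sign `s`
determines the direction of this step. -/
def loopSuccessors : Option (Bool × Fin r) → Bool → Finset (Option (Bool × Fin r))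
  | none, s => {place s 1, place s r}
  | some (l, i), s => {if s = alternate l (i + 1) then place l (i + 2) else place l i}

theorem card_loopSuccessors_le (o : Option (Bool × Fin r)) (s : Bool) :
    (loopSuccessors o s).card ≤ 2 := by
  obtain _ | ⟨l, i⟩ := o
  · exact Finset.card_le_two
  · rw [loopSuccessors, Finset.card_singleton]
    exact one_le_two

theorem place_succ_mem_loopSuccessors (l : Bool) {p : ℕ} (hp : p ≤ r) :
    place (r := r) l (p + 1) ∈ loopSuccessors (place l p) (alternate l p) := by
  cases p with
  | zero => simp [place_zero, loopSuccessors, alternate_zero]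
  | succ p => simp [place_succ l hp, loopSuccessors]

theorem place_mem_loopSuccessors (hr : Even r) (l : Bool) {p : ℕ} (hp : p ≤ r) :
    place (r := r) l p ∈ loopSuccessors (place l (p + 1)) (alternate l p) := by
  obtain rfl | hp := hp.eq_or_lt
  · simp [place_last, loopSuccessors, alternate_of_even hr]
  · simp [place_succ l hp, loopSuccessors, alternate_succ]

theorem exists_mem_loopSuccessors_of_loopStep_ne_zero (hr : Even r) (hv : Function.Injective v)
    {o : Option (Bool × Fin r)} {s : Bool} {b : Fin n} (h : loopStep v (!s) (v o) b ≠ 0) :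
    ∃ o' ∈ loopSuccessors o s, v o' = b := by
  obtain ⟨l, p, hp, hs, ⟨ho, hb⟩ | ⟨hb, ho⟩⟩ := exists_place_of_loopStep_ne_zero h
  all_goals
    rw [alternate_succ, Bool.not_inj_iff] at hs
    rw [← hv ho, ← hs]
  · exact ⟨_, place_succ_mem_loopSuccessors l hp, hb⟩
  · exact ⟨_, place_mem_loopSuccessors hr l hp, hb⟩

theorem transfer_loopStep_apply_le (hr : Even r) (hv : Function.Injective v)
    {f : Fin n → Bool → ℝ} (hf : 0 ≤ f) (o : Option (Bool × Fin r)) (s : Bool) :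
    transfer (loopStep v) f (v o) s ≤ ∑ o' ∈ loopSuccessors o s, f (v o') (!s) := by
  classical
  calc ∑ b, loopStep v (!s) (v o) b * f b (!s)
      = ∑ b ∈ (loopSuccessors o s).image v, loopStep v (!s) (v o) b * f b (!s) := by
        refine (Finset.sum_subset (Finset.subset_univ _) fun b _ hb => ?_).symm
        refine mul_eq_zero_of_left (by_contra fun h => hb (Finset.mem_image.2 ?_)) _
        exact exists_mem_loopSuccessors_of_loopStep_ne_zero hr hv h
    _ ≤ ∑ b ∈ (loopSuccessors o s).image v, f b (!s) :=
        Finset.sum_le_sum fun b _ => mul_le_of_le_one_left (hf b _) (loopStep_le_one _ _ _)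
    _ = ∑ o' ∈ loopSuccessors o s, f (v o') (!s) := Finset.sum_image hv.injOn

/-- A growth weight on the points of a pair of loops. A walk that continues along a loop gains the
factor `ρ` with every step until it reaches the common point, whose weight `2` is that of its two
successors divided by `ρ`. -/
def loopWeight (ρ : ℝ) : Option (Bool × Fin r) → Bool → ℝ
  | none, _ => 2
  | some (l, i), s => if s = alternate l (i + 1) then ρ ^ (i + 1 : ℕ) else ρ ^ (r - i)

theorem one_le_loopWeight (hρ : 1 ≤ ρ) (o : Option (Bool × Fin r)) (s : Bool) :
    1 ≤ loopWeight ρ o s := by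
  obtain _ | ⟨l, i⟩ := o
  · exact one_le_two
  · rw [loopWeight]
    split_ifs <;> exact one_le_pow₀ hρ

theorem loopWeight_le {c : ℝ} (hρ : 1 ≤ ρ) (hc : ρ ^ (r + 1) ≤ c) (hc_two : 2 ≤ c)
    (o : Option (Bool × Fin r)) (s : Bool) : loopWeight ρ o s ≤ c := by
  obtain _ | ⟨l, i⟩ := o
  · exact hc_two
  · rw [loopWeight]
    split_ifs <;> exact (pow_le_pow_right₀ hρ (by omega)).trans hc

theorem loopWeight_place_succ_le (hρ : 2 ≤ ρ ^ (r + 1)) (l : Bool) {p : ℕ} (hp : p ≤ r) :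
    loopWeight ρ (place (r := r) l (p + 1)) (alternate l (p + 1)) ≤ ρ ^ (p + 1) := by
  obtain rfl | hp := hp.eq_or_lt
  · rwa [place_last, loopWeight]
  · rw [place_succ l hp, loopWeight, if_pos rfl]

theorem loopWeight_place_le (hρ : 2 ≤ ρ ^ (r + 1)) (l : Bool) {p : ℕ} (hp : p ≤ r) :
    loopWeight ρ (place (r := r) l p) (alternate l (p + 1)) ≤ ρ ^ (r + 1 - p) := by
  cases p with
  | zero => rwa [place_zero, loopWeight]
  | succ p =>
    rw [place_succ l hp, loopWeight, if_neg (by simp [alternate_succ]), Nat.succ_sub_succ]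

theorem sum_loopSuccessors_loopWeight_le (hr : Even r) (hρ : 2 ≤ ρ ^ (r + 1)) (hρ_nonneg : 0 ≤ ρ)
    (o : Option (Bool × Fin r)) (s : Bool) :
    ∑ o' ∈ loopSuccessors o s, loopWeight ρ o' (!s) ≤ ρ * loopWeight ρ o s := by
  obtain _ | ⟨l, i⟩ := o
  · have hle : ∀ o' ∈ loopSuccessors (r := r) none s, loopWeight ρ o' (!s) ≤ ρ := by
      simp only [loopSuccessors, Finset.mem_insert, Finset.mem_singleton, forall_eq_or_imp,
        forall_eq]
      constructor
      · simpa [alternate_succ, alternate_zero] using loopWeight_place_succ_le hρ s r.zero_le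
      · simpa [alternate_succ, alternate_of_even hr] using loopWeight_place_le hρ s le_rfl
    have hcard : ((loopSuccessors (r := r) none s).card : ℝ) ≤ 2 :=
      mod_cast card_loopSuccessors_le none s
    calc _ ≤ (loopSuccessors (r := r) none s).card • ρ := Finset.sum_le_card_nsmul _ _ _ hle
      _ ≤ ρ * 2 := by rw [nsmul_eq_mul, mul_comm]; gcongr
  · rw [loopSuccessors, Finset.sum_singleton, loopWeight]
    split_ifs with hs
    · rw [hs, ← alternate_succ, ← pow_succ']
      exact loopWeight_place_succ_le hρ l i.isLt
    · rw [Bool.not_eq.2 hs, ← pow_succ', ← Nat.sub_add_comm i.is_le']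
      exact loopWeight_place_le hρ l i.is_le'

/-- The growth weight `loopWeight` in terms of the variables on the pair of loops `v`, extended
by `0`. -/
noncomputable def pointWeight (v : Option (Bool × Fin r) → Fin n) (ρ : ℝ) : Fin n → Bool → ℝ :=
  Function.extend v (loopWeight ρ) 0

theorem pointWeight_apply (hv : Function.Injective v) (o : Option (Bool × Fin r)) :
    pointWeight v ρ (v o) = loopWeight ρ o :=
  hv.extend_apply _ _ o

theorem pointWeight_of_notMem_range {a : Fin n} (ha : a ∉ Set.range v) : pointWeight v ρ a = 0 :=
  Function.extend_apply' _ _ a ha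

theorem pointWeight_nonneg (hv : Function.Injective v) (hρ : 1 ≤ ρ) : 0 ≤ pointWeight v ρ := by
  intro a s
  by_cases ha : a ∈ Set.range v
  · obtain ⟨o, rfl⟩ := ha
    rw [pointWeight_apply hv]
    exact zero_le_one.trans (one_le_loopWeight hρ o s)
  · exact (congrFun (pointWeight_of_notMem_range ha) s).ge

theorem sum_pointWeight (hv : Function.Injective v) (s : Bool) :
    ∑ a, pointWeight v ρ a s = ∑ o : Option (Bool × Fin r), loopWeight ρ o s :=
  (Fintype.sum_of_injective v hv _ _ (fun a ha => by rw [pointWeight_of_notMem_range ha]; rfl)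
    fun o => by rw [pointWeight_apply hv]).symm

theorem transfer_loopStep_le_smul_of_forall {f ψ : Fin n → Bool → ℝ} {c : ℝ} (hc : 0 ≤ c)
    (hψ : 0 ≤ ψ) (h : ∀ o s, transfer (loopStep v) f (v o) s ≤ c * ψ (v o) s) :
    transfer (loopStep v) f ≤ c • ψ := by
  intro a s
  by_cases ha : a ∈ Set.range v
  · obtain ⟨o, rfl⟩ := ha
    exact h o s
  · rw [transfer_apply, Finset.sum_eq_zero fun b _ => by
      rw [loopStep_of_notMem_range_left ha, zero_mul]]
    exact mul_nonneg hc (hψ a s)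

theorem isGrowthWeight_pointWeight (hr : Even r) (hv : Function.Injective v)
    (hρ : 1 ≤ ρ) (hρ_two : 2 ≤ ρ ^ (r + 1)) (hρ_three : ρ ^ (r + 1) ≤ 3) :
    IsGrowthWeight (loopStep v) (pointWeight v ρ) ρ (6 * (r + 1)) where
  nonneg := pointWeight_nonneg hv hρ
  transfer_le := by
    refine transfer_loopStep_le_smul_of_forall (by linarith) (pointWeight_nonneg hv hρ)
      fun o s => ?_
    refine (transfer_loopStep_apply_le hr hv (pointWeight_nonneg hv hρ) o s).trans ?_
    simp only [pointWeight_apply hv]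
    exact sum_loopSuccessors_loopWeight_le hr hρ_two (by linarith) o s
  transfer_one_le := by
    refine transfer_loopStep_le_smul_of_forall two_pos.le (pointWeight_nonneg hv hρ)
      fun o s => ?_
    have hcard : ((loopSuccessors o s).card : ℝ) ≤ 2 := mod_cast card_loopSuccessors_le o s
    have hsum := transfer_loopStep_apply_le hr hv zero_le_one o s
    simp only [Pi.one_apply, Finset.sum_const, nsmul_eq_mul, mul_one] at hsum
    rw [pointWeight_apply hv]
    linarith [one_le_loopWeight hρ o s]
  sum_le s := by
    rw [sum_pointWeight hv]
    calc ∑ o, loopWeight ρ o s ≤ ∑ _o : Option (Bool × Fin r), 3 :=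
          Finset.sum_le_sum fun o _ => loopWeight_le hρ hρ_three (by norm_num) o s
      _ ≤ 6 * (r + 1) := by
          simp only [Finset.sum_const, Finset.card_univ, Fintype.card_option, Fintype.card_prod,
            Fintype.card_bool, Fintype.card_fin, nsmul_eq_mul]
          push_cast
          linarith

/-- An assignment of variables to the points of a pair of loops, as the variable at the common
point together with the variables along each of the two loops. -/
def loopEquiv (r : ℕ) (α : Type*) :
    (Option (Bool × Fin r) → α) ≃ α × (Bool → Fin r → α) where
  toFun f := (f none, fun l i => f (some (l, i)))
  invFun x o := o.elim x.1 fun z => x.2 z.1 z.2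
  left_inv f := by funext o; cases o <;> rfl
  right_inv _ := rfl

theorem loopEquiv_symm_place {α : Type*} (x : α) (y : Bool → Fin r → α) (l : Bool) (p : ℕ) :
    (loopEquiv r α).symm (x, y) (place l p) = path x (y l) x p := by
  cases p with
  | zero => rfl
  | succ p => by_cases hp : p < r <;> simp only [place, path, hp, dite_true, dite_false] <;> rfl

theorem sum_prod_loopClause_le {θ : ℝ} (hθ : 0 ≤ θ) :
    ∑ t : Option (Bool × Fin r) ↪ Fin n, ∏ j,
        (θ + (Set.range (loopClause v)).indicator 1 (loopClause t j)) ≤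
      ∑ x, ∏ l, (transfer (fun s a b => θ + loopStep v s a b) ^ (r + 1)) (Pi.single x 1) x l :=
  calc _ ≤ ∑ t : Option (Bool × Fin r) → Fin n, ∏ j,
          (θ + (Set.range (loopClause v)).indicator 1 (loopClause t j)) :=
        sum_embedding_le_sum fun t => Finset.prod_nonneg fun j _ =>
          add_nonneg hθ (Set.indicator_nonneg (fun _ _ => zero_le_one) _)
    _ = ∑ x, ∑ y : Bool → Fin r → Fin n, ∏ l, ∏ p ∈ Finset.range (r + 1),
          (θ + loopStep v (alternate l (p + 1)) (path x (y l) x p) (path x (y l) x (p + 1))) := by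
        rw [← (loopEquiv r (Fin n)).symm.sum_comp, Fintype.sum_prod_type]
        simp only [Fintype.prod_prod_type, Finset.prod_range, loopStep, loopClause_eq,
          loopEquiv_symm_place]
    _ = _ := by
        simp only [← sum_prod_path, Finset.prod_univ_sum, Fintype.piFinset_univ]

end Overlaps

section Law

theorem pi_dirac {ι : Type*} [Fintype ι] {X : ι → Type*} [∀ i, MeasurableSpace (X i)]
    (x : ∀ i, X i) : Measure.pi (fun i => Measure.dirac (x i)) = Measure.dirac x :=
  Measure.pi_eq fun s hs => by
    classical
    simp [Measure.dirac_apply', MeasurableSet.univ_pi hs, hs, Set.indicator_apply,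
      Finset.prod_ite_zero]

variable {n k : ℕ}

theorem isProbabilityMeasure_uniformOn_injective (hk : k ≤ n) :
    IsProbabilityMeasure (uniformOn {K : Fin k → Fin n | Function.Injective K}) :=
  isProbabilityMeasure_uniformOn (Set.toFinite _) ⟨Fin.castLE hk, Fin.castLE_injective hk⟩

theorem isProbabilityMeasure_seedLaw (hk : k ≤ n) (p : unitInterval) :
    IsProbabilityMeasure (seedLaw n k p) := by
  have := isProbabilityMeasure_uniformOn_injective hk
  rw [seedLaw]
  infer_instance

theorem isProbabilityMeasure_modelLaw (hk : k ≤ n) (p : unitInterval) (m : ℕ) :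
    IsProbabilityMeasure (modelLaw n k p m) := by
  have := isProbabilityMeasure_seedLaw hk p
  rw [modelLaw]
  infer_instance

theorem prob_mono (hk : k ≤ n) (p : unitInterval) {m : ℕ} {Q Q' : Formula n m → Prop}
    (h : ∀ F, Q F → Q' F) : prob n k p m Q ≤ prob n k p m Q' := by
  have := isProbabilityMeasure_modelLaw hk p m
  exact measureReal_mono fun _ => h _

theorem prob_le_one (hk : k ≤ n) (p : unitInterval) {m : ℕ} (Q : Formula n m → Prop) :
    prob n k p m Q ≤ 1 := by
  have := isProbabilityMeasure_modelLaw hk p m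
  exact measureReal_le_one

theorem seedLaw_zero (hk : k ≤ n) : seedLaw n k 0 =
    ((uniformOn {K : Fin k → Fin n | Function.Injective K}).prod
      (uniformOn (Set.univ : Set Bool))).map fun x => (x.1, x.2, fun _ => false) := by
  have := isProbabilityMeasure_uniformOn_injective hk
  simp only [seedLaw, bernoulliMeasure_zero, pi_dirac, Measure.prod_dirac]
  conv_lhs => rw [← Measure.map_id (μ := uniformOn {K : Fin k → Fin n | Function.Injective K})]
  exact Measure.map_prod_map _ _ measurable_id (by fun_prop)

theorem Seed.clause_false_eq_iff {K : Fin 2 → Fin n} {B : Bool} {u v : Fin n} {b : Bool} :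
    Seed.clause (K, B, fun _ => false) = {(u, b), (v, b)} ↔
      (K, B) ∈ ({![u, v], ![v, u]} : Finset (Fin 2 → Fin n)) ×ˢ ({!b} : Finset Bool) := by
  have hclause : Seed.clause (K, B, fun _ => false) = {(K 0, !B), (K 1, !B)} := by
    ext z
    simp [Seed.clause, Fin.exists_fin_two, eq_comm]
  have hpair (a c : Fin n) : K = ![a, c] ↔ K 0 = a ∧ K 1 = c := by
    simp [funext_iff, Fin.forall_fin_two]
  rw [hclause, Finset.mem_product, Finset.mem_insert, Finset.mem_singleton, Finset.mem_singleton,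
    hpair, hpair]
  constructor
  · intro h
    obtain ⟨hB, hK⟩ := eq_of_pair_eq_pair h
    exact ⟨hK, by rw [← hB, Bool.not_not]⟩
  · rintro ⟨⟨rfl, rfl⟩ | ⟨rfl, rfl⟩, rfl⟩
    · rw [Bool.not_not]
    · rw [Bool.not_not, Finset.pair_comm]

theorem uniformOn_injective_real_pair {u v : Fin n} (huv : u ≠ v) :
    (uniformOn {K : Fin 2 → Fin n | Function.Injective K}).real
      ({![u, v], ![v, u]} : Finset (Fin 2 → Fin n)) = 2 / (n * (n - 1)) := by
  classical
  have hn : 1 ≤ n := u.pos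
  have hinj {a c : Fin n} (hac : a ≠ c) : Function.Injective ![a, c] := by
    simpa [Function.Injective, Fin.forall_fin_two, hac.symm] using hac
  have hset : {K : Fin 2 → Fin n | Function.Injective K} =
      (Finset.univ.filter fun K : Fin 2 → Fin n => Function.Injective K : Finset _) := by
    ext
    simp
  have hcard : (Finset.univ.filter fun K : Fin 2 → Fin n => Function.Injective K).card =
      n * (n - 1) := by
    rw [← Fintype.card_subtype,
      Fintype.card_congr (Equiv.subtypeInjectiveEquivEmbedding (Fin 2) (Fin n)),
      Fintype.card_embedding_eq]
    simp [Nat.descFactorial, mul_comm]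
  rw [measureReal_def, hset, uniformOn_apply_finset, Finset.inter_eq_right.2, hcard,
    Finset.card_pair]
  · rw [ENNReal.toReal_div, ENNReal.toReal_natCast, ENNReal.toReal_natCast]
    push_cast [hn]
    rfl
  · exact fun h => huv (congrFun h 0)
  · simp [Finset.insert_subset_iff, hinj huv, hinj huv.symm]

theorem seedLaw_real_clause_eq {u v : Fin n} (huv : u ≠ v) (b : Bool) :
    (seedLaw n 2 0).real (Seed.clause ⁻¹' {{(u, b), (v, b)}}) = 1 / (n * (n - 1)) := by
  have hn : 2 ≤ n := by omega
  have hpreimage : (fun x : (Fin 2 → Fin n) × Bool => ((x.1, x.2, fun _ => false) : Seed n 2)) ⁻¹'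
      (Seed.clause ⁻¹' {{(u, b), (v, b)}}) =
      (({![u, v], ![v, u]} : Finset (Fin 2 → Fin n)) : Set _) ×ˢ {!b} := by
    ext x
    refine Seed.clause_false_eq_iff.trans ?_
    rw [Finset.mem_product, Finset.mem_singleton]
    rfl
  have hbool : (uniformOn (Set.univ : Set Bool)).real {!b} = 1 / 2 := by
    rw [measureReal_def, uniformOn_univ]
    simp
  have := isProbabilityMeasure_uniformOn_injective hn
  rw [seedLaw_zero hn, map_measureReal_apply (by fun_prop) .of_discrete, hpreimage,
    measureReal_prod_prod, uniformOn_injective_real_pair huv, hbool]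
  ring

theorem descFactorial_mul_le_prob_hasUnicycle_mul {m r : ℕ} (hn : 2 ≤ n) (hr : Even r)
    (hr_two : 2 ≤ r) {q C : ℝ} (hq : q = 1 / (n * (n - 1))) (hC_nonneg : 0 ≤ C)
    (hC : ∀ v : Option (Bool × Fin r) ↪ Fin n,
      ∑ x, ∏ l, (transfer (fun s a b => m * q + loopStep v s a b) ^ (r + 1)) (Pi.single x 1) x l ≤
        C) :
    (n.descFactorial (2 * r + 1) : ℝ) * m.descFactorial (2 * (r + 1)) * q ^ (2 * (r + 1)) ≤
      prob n 2 0 m (fun F => HasUnicycle (implicationDigraph F)) * C := by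
  have := isProbabilityMeasure_seedLaw hn 0
  have := isProbabilityMeasure_modelLaw hn 0 m
  let _ : MeasurableSpace (Clause n) := ⊤
  have : DiscreteMeasurableSpace (Clause n) := ⟨fun _ => trivial⟩
  have hq_nonneg : 0 ≤ q := by
    have : (2 : ℝ) ≤ n := mod_cast hn
    exact hq ▸ div_nonneg zero_le_one (mul_nonneg (by linarith) (by linarith))
  have hlaw (v : Option (Bool × Fin r) ↪ Fin n) (j : Bool × Fin (r + 1)) :
      (seedLaw n 2 0).real (Seed.clause ⁻¹' {loopClause v j}) = q := by
    rw [hq, loopClause_eq]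
    exact seedLaw_real_clause_eq
      (v.injective.ne (place_ne_place_succ (by omega) j.1 j.2)) _
  have hsecond := card_mul_le_measureReal_exists_occurrence_mul (κ := Fin m) (ν := seedLaw n 2 0)
    (X := Seed.clause) (e := fun v : Option (Bool × Fin r) ↪ Fin n => loopClause v)
    .of_discrete (fun v => loopClause_injective hr_two v.injective) hlaw hq_nonneg fun v =>
      (sum_prod_loopClause_le (by positivity)).trans (by simpa using hC v)
  simp only [Fintype.card_embedding_eq, Fintype.card_option, Fintype.card_prod, Fintype.card_bool,
    Fintype.card_fin] at hsecond
  refine hsecond.trans (mul_le_mul_of_nonneg_right (measureReal_mono ?_) hC_nonneg)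
  rintro ω ⟨v, φ, hφ⟩
  exact ⟨_, _, isUnicycle_loopCycle hr v.injective fun j => ⟨φ j, hφ j⟩⟩

end Law

section Rate

/-- The factor by which walks along the loops of a pair of loops with `r + 1` steps each gain weight
in every step. It is so small that a whole loop gains at most the factor `3`. -/
noncomputable def loopRate (r : ℕ) : ℝ := 1 + 1 / (r + 1)

theorem one_le_loopRate (r : ℕ) : 1 ≤ loopRate r :=
  le_add_of_nonneg_right Nat.one_div_pos_of_nat.le

theorem two_le_loopRate_pow (r : ℕ) : 2 ≤ loopRate r ^ (r + 1) := by
  have hinv : 0 < 1 / ((r : ℝ) + 1) := Nat.one_div_pos_of_nat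
  refine le_of_eq_of_le ?_ (one_add_mul_le_pow (show -2 ≤ 1 / ((r : ℝ) + 1) by linarith) (r + 1))
  push_cast
  field_simp
  norm_num

theorem add_pow_le_pow_mul_exp {x y : ℝ} (hx : 0 < x) (hxy : 0 ≤ x + y) (k : ℕ) :
    (x + y) ^ k ≤ x ^ k * Real.exp (k * (y / x)) := by
  calc (x + y) ^ k ≤ (x * Real.exp (y / x)) ^ k := by
        refine pow_le_pow_left₀ hxy ?_ k
        calc x + y = x * (y / x + 1) := by field_simp; ring
          _ ≤ x * Real.exp (y / x) := by gcongr; exact Real.add_one_le_exp _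
    _ = x ^ k * Real.exp (k * (y / x)) := by rw [mul_pow, Real.exp_nat_mul]

theorem loopRate_pow_le_three (r : ℕ) : loopRate r ^ (r + 1) ≤ 3 := by
  have hinv : 0 < 1 / ((r : ℝ) + 1) := Nat.one_div_pos_of_nat
  calc loopRate r ^ (r + 1) ≤ 1 ^ (r + 1) * Real.exp ((r + 1 : ℕ) * (1 / (r + 1) / 1)) :=
        add_pow_le_pow_mul_exp one_pos (by linarith) _
    _ = Real.exp 1 := by
        push_cast
        rw [one_pow, one_mul, div_one, mul_one_div_cancel (by positivity)]
    _ ≤ 3 := Real.exp_one_lt_three.le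

end Rate

section LoopSum

variable {n r : ℕ} {v : Option (Bool × Fin r) → Fin n} {θ ε δ : ℝ}

theorem isGrowthWeight_pointWeight_loopRate (hr : Even r) (hv : Function.Injective v) :
    IsGrowthWeight (loopStep v) (pointWeight v (loopRate r)) (loopRate r) (6 * (r + 1)) :=
  isGrowthWeight_pointWeight hr hv (one_le_loopRate r) (two_le_loopRate_pow r)
    (loopRate_pow_le_three r)

theorem two_le_mul_sub_loopRate (hε : 0 < ε) (hεθ : 1 + ε ≤ n * θ) (hεr : 2 ≤ ε * (r + 1)) :
    2 ≤ 4 / ε * (Fintype.card (Fin n) * θ - loopRate r) := by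
  have hrate : 1 / ((r : ℝ) + 1) ≤ ε / 2 := by
    rw [div_le_div_iff₀ (by positivity) two_pos]
    linarith
  calc 2 = 4 / ε * (ε / 2) := by field_simp; norm_num
    _ ≤ _ := by rw [Fintype.card_fin, loopRate]; gcongr; linarith

theorem growth_pow_le (hn : 0 < n) (hθ : 0 < θ) (hε : 0 < ε)
    (hδ : ((r : ℝ) + 1) ^ 2 ≤ δ * (ε * n)) :
    (n * θ + θ * (4 / ε * (6 * (r + 1)))) ^ (r + 1) ≤ (n * θ) ^ (r + 1) * Real.exp (24 * δ) := by
  refine (add_pow_le_pow_mul_exp (by positivity) (by positivity) _).trans ?_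
  refine mul_le_mul_of_nonneg_left (Real.exp_le_exp.2 ?_) (by positivity)
  push_cast
  rw [← mul_div_assoc, div_le_iff₀ (by positivity)]
  calc (r + 1) * (θ * (4 / ε * (6 * (r + 1)))) = 24 * (r + 1) ^ 2 * (θ / ε) := by ring
    _ ≤ 24 * (δ * (ε * n)) * (θ / ε) := by gcongr
    _ = 24 * δ * (n * θ) := by field_simp

theorem mul_growth_pow_le (hn : 0 < n) (hθ : 0 < θ) (hε : 0 < ε)
    (hδ : ((r : ℝ) + 1) ^ 2 ≤ δ * (ε * n)) :
    θ * (n * θ + θ * (4 / ε * (6 * (r + 1)))) ^ r ≤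
      (n * θ) ^ (r + 1) * Real.exp (24 * δ) * (1 / n) := by
  calc θ * (n * θ + θ * (4 / ε * (6 * (r + 1)))) ^ r
      ≤ (n * θ + θ * (4 / ε * (6 * (r + 1)))) * (1 / n) *
          (n * θ + θ * (4 / ε * (6 * (r + 1)))) ^ r := by
        gcongr
        rw [mul_one_div, le_div_iff₀ (by positivity), mul_comm]
        exact le_add_of_nonneg_right (by positivity)
    _ = (n * θ + θ * (4 / ε * (6 * (r + 1)))) ^ (r + 1) * (1 / n) := by ring
    _ ≤ _ := by gcongr; exact growth_pow_le hn hθ hε hδ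

theorem one_le_pow_mul_exp_mul (hε : 0 < ε) (hεθ : 1 + ε ≤ n * θ) (hεn : n ≤ (1 + ε) ^ (r + 1))
    (hδ_nonneg : 0 ≤ δ) (hδ_inv : 1 ≤ δ * n) :
    1 ≤ (n * θ) ^ (r + 1) * Real.exp (24 * δ) * δ := by
  have hpow : n ≤ (n * θ) ^ (r + 1) := hεn.trans (by gcongr)
  have hpow_nonneg : 0 ≤ (n * θ) ^ (r + 1) := n.cast_nonneg.trans hpow
  have hexp : 1 ≤ Real.exp (24 * δ) := Real.one_le_exp (by positivity)
  calc 1 ≤ n * 1 * δ := by linarith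
    _ ≤ _ := by gcongr

theorem mul_growth_pow_mul_le (hn : 0 < n) (hθ : 0 < θ) (hε : 0 < ε) (hε_le : ε ≤ 1)
    (hδ : ((r : ℝ) + 1) ^ 2 ≤ δ * (ε * n)) {w : ℝ} (hw_nonneg : 0 ≤ w) (hw : w ≤ 3) :
    (r + 1) * (θ * (6 * (r + 1))) * (n * θ + θ * (4 / ε * (6 * (r + 1)))) ^ r *
      (1 + 4 / ε * w) ≤ (n * θ) ^ (r + 1) * Real.exp (24 * δ) * (78 * δ) := by
  have hδ_nonneg : 0 ≤ δ := nonneg_of_mul_nonneg_left ((sq_nonneg _).trans hδ) (by positivity)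
  have hstart : 1 + 4 / ε * w ≤ 13 / ε := by
    calc 1 + 4 / ε * w ≤ 1 / ε + 4 / ε * 3 := by gcongr; exact one_le_one_div hε hε_le
      _ = 13 / ε := by ring
  calc _ = 6 * (r + 1) ^ 2 * (θ * (n * θ + θ * (4 / ε * (6 * (r + 1)))) ^ r) *
        (1 + 4 / ε * w) := by ring
    _ ≤ 6 * (δ * (ε * n)) * ((n * θ) ^ (r + 1) * Real.exp (24 * δ) * (1 / n)) * (13 / ε) := by
      refine mul_le_mul (mul_le_mul ?_ ?_ ?_ ?_) hstart ?_ ?_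
      · gcongr
      · exact mul_growth_pow_le hn hθ hε hδ
      all_goals positivity
    _ = _ := by field_simp; ring

theorem pow_transfer_single_le_of_notMem_range (hr : Even r) (hv : Function.Injective v)
    (hθ : 0 < θ) (hε : 0 < ε) (hεθ : 1 + ε ≤ n * θ) (hεr : 2 ≤ ε * (r + 1))
    (hδ : ((r : ℝ) + 1) ^ 2 ≤ δ * (ε * n)) {x : Fin n} (hx : x ∉ Set.range v) (l : Bool) :
    (transfer (fun s a b => θ + loopStep v s a b) ^ (r + 1)) (Pi.single x 1) x l ≤
      (n * θ) ^ (r + 1) * Real.exp (24 * δ) * (1 / n) := by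
  have hbound := IsGrowthWeight.pow_transfer_single_le_of_forall_eq_zero
    (isGrowthWeight_pointWeight_loopRate hr hv) loopStep_nonneg hθ.le (by positivity)
    (two_le_mul_sub_loopRate hε hεθ hεr) (fun s u => loopStep_of_notMem_range_right hx s u) r x l
  simp only [Pi.smul_apply, Pi.add_apply, pointWeight_of_notMem_range hx,
    Pi.one_apply, smul_zero, add_zero, smul_eq_mul, mul_one, Fintype.card_fin] at hbound
  exact hbound.trans (mul_growth_pow_le x.pos hθ hε hδ)

theorem pow_transfer_single_le_of_mem_range (hr : Even r) (hv : Function.Injective v)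
    (hθ : 0 < θ) (hε : 0 < ε) (hε_le : ε ≤ 1) (hεθ : 1 + ε ≤ n * θ) (hεr : 2 ≤ ε * (r + 1))
    (hεn : n ≤ (1 + ε) ^ (r + 1)) (hδ : ((r : ℝ) + 1) ^ 2 ≤ δ * (ε * n)) {x : Fin n}
    (hx : x ∈ Set.range v) (l : Bool) :
    (transfer (fun s a b => θ + loopStep v s a b) ^ (r + 1)) (Pi.single x 1) x l ≤
      (n * θ) ^ (r + 1) * Real.exp (24 * δ) * (87 * δ) := by
  obtain ⟨o, rfl⟩ := hx
  have hn : 0 < n := (v o).pos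
  have hδ_nonneg : 0 ≤ δ := nonneg_of_mul_nonneg_left ((sq_nonneg _).trans hδ) (by positivity)
  have hδ_inv : 1 ≤ δ * n := by
    calc (1 : ℝ) ≤ (r + 1) ^ 2 := one_le_pow₀ (le_add_of_nonneg_left r.cast_nonneg)
      _ ≤ δ * (1 * n) := hδ.trans (by gcongr)
      _ = δ * n := by rw [one_mul]
  have hweight_le : loopWeight (loopRate r) o l ≤ 3 :=
    loopWeight_le (one_le_loopRate r) (loopRate_pow_le_three r) (by norm_num) o l
  have hweight_nonneg : 0 ≤ loopWeight (loopRate r) o l :=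
    zero_le_one.trans (one_le_loopWeight (one_le_loopRate r) o l)
  have hbound := (isGrowthWeight_pointWeight_loopRate hr hv).pow_transfer_single_le
    (b := v o) loopStep_nonneg hθ.le (by positivity) (zero_le_one.trans (one_le_loopRate r))
    (two_le_mul_sub_loopRate hε hεθ hεr)
    (pointWeight_apply hv (ρ := loopRate r) o ▸ fun s => one_le_loopWeight (one_le_loopRate r) o s)
    r (v o) l
  simp only [Pi.smul_apply, Pi.add_apply, pointWeight_apply hv, Pi.one_apply, smul_eq_mul,
    Fintype.card_fin] at hbound
  have halong : loopRate r ^ (r + 1) * loopWeight (loopRate r) o l ≤ 3 * 3 := by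
    gcongr
    exact loopRate_pow_le_three r
  linarith [one_le_pow_mul_exp_mul hε hεθ hεn hδ_nonneg hδ_inv,
    mul_growth_pow_mul_le hn hθ hε hε_le hδ hweight_nonneg hweight_le]

theorem pow_transfer_single_nonneg (hθ : 0 ≤ θ) (x : Fin n) (l : Bool) :
    0 ≤ (transfer (fun s a b => θ + loopStep v s a b) ^ (r + 1)) (Pi.single x 1) x l := by
  rw [← sum_prod_path]
  exact Finset.sum_nonneg fun _ _ => Finset.prod_nonneg fun _ _ =>
    add_nonneg hθ (loopStep_nonneg _ _ _)

theorem sum_prod_pow_transfer_single_le (hr : Even r) (hv : Function.Injective v)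
    (hθ : 0 < θ) (hε : 0 < ε) (hε_le : ε ≤ 1) (hεθ : 1 + ε ≤ n * θ) (hεr : 2 ≤ ε * (r + 1))
    (hεn : n ≤ (1 + ε) ^ (r + 1)) (hδ : ((r : ℝ) + 1) ^ 2 ≤ δ * (ε * n)) :
    ∑ x, ∏ l, (transfer (fun s a b => θ + loopStep v s a b) ^ (r + 1)) (Pi.single x 1) x l ≤
      (n * θ) ^ (2 * (r + 1)) / n * (Real.exp (48 * δ) * (1 + 15138 * ((r + 1) * n * δ ^ 2))) := by
  have hn : 0 < n := (v none).pos
  set M := (n * θ) ^ (r + 1) * Real.exp (24 * δ) with hM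
  have hM_sq : M ^ 2 = (n * θ) ^ (2 * (r + 1)) * Real.exp (48 * δ) := by
    rw [hM, mul_pow, ← pow_mul, mul_comm (r + 1), ← Real.exp_nat_mul]
    congr 2
    push_cast
    ring
  have hterm : ∀ x, ∏ l, (transfer (fun s a b => θ + loopStep v s a b) ^ (r + 1))
      (Pi.single x 1) x l ≤
        (M * (1 / n)) ^ 2 + (Set.range v).indicator (fun _ => (M * (87 * δ)) ^ 2) x := by
    intro x
    by_cases hx : x ∈ Set.range v
    · refine (Finset.prod_le_prod (fun l _ => pow_transfer_single_nonneg hθ.le x l) fun l _ =>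
        pow_transfer_single_le_of_mem_range hr hv hθ hε hε_le hεθ hεr hεn hδ hx l).trans ?_
      rw [Finset.prod_const, Finset.card_univ, Fintype.card_bool, Set.indicator_of_mem hx]
      exact le_add_of_nonneg_left (sq_nonneg _)
    · refine (Finset.prod_le_prod (fun l _ => pow_transfer_single_nonneg hθ.le x l) fun l _ =>
        pow_transfer_single_le_of_notMem_range hr hv hθ hε hεθ hεr hδ hx l).trans ?_
      rw [Finset.prod_const, Finset.card_univ, Fintype.card_bool, Set.indicator_of_notMem hx,
        add_zero]
  calc _ ≤ ∑ x, ((M * (1 / n)) ^ 2 + (Set.range v).indicator (fun _ => (M * (87 * δ)) ^ 2) x) :=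
        Finset.sum_le_sum fun x _ => hterm x
    _ = n * (M * (1 / n)) ^ 2 + (2 * r + 1) * (M * (87 * δ)) ^ 2 := by
        rw [Finset.sum_add_distrib, ← Fintype.sum_of_injective v hv (fun _ => (M * (87 * δ)) ^ 2) _
          (fun x hx => Set.indicator_of_notMem hx _)
          fun o => (Set.indicator_of_mem (Set.mem_range_self o) fun _ => _).symm]
        simp [mul_comm]
    _ ≤ n * (M * (1 / n)) ^ 2 + (2 * r + 2) * (M * (87 * δ)) ^ 2 := by gcongr; norm_num
    _ = M ^ 2 / n * (1 + 15138 * ((r + 1) * n * δ ^ 2)) := by field_simp; ring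
    _ = _ := by rw [hM_sq]; ring

end LoopSum

section Counting

theorem pow_mul_one_sub_le_descFactorial {N k : ℕ} {δ : ℝ} (hN : 0 < N) (hk : (k : ℝ) ^ 2 ≤ δ * N) :
    (N : ℝ) ^ k * (1 - δ) ≤ N.descFactorial k := by
  have hδ : (k : ℝ) ^ 2 / N ≤ δ := (div_le_iff₀ (by positivity)).2 hk
  rcases le_or_gt k N with hkN | hkN
  · have hk_le_one : (k : ℝ) / N ≤ 1 := div_le_one_of_le₀ (mod_cast hkN) (by positivity)
    calc (N : ℝ) ^ k * (1 - δ) ≤ N ^ k * (1 + k * -(k / N)) := by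
          gcongr
          linarith [show (k : ℝ) * -(k / N) = -(k ^ 2 / N) by ring]
      _ ≤ N ^ k * (1 + -(k / N)) ^ k := by
          gcongr
          exact one_add_mul_le_pow (by linarith) k
      _ = (N - k : ℕ) ^ k := by
          rw [← mul_pow, Nat.cast_sub hkN]
          field_simp
          ring
      _ ≤ N.descFactorial k := by
          exact_mod_cast (Nat.pow_le_pow_left (by omega) k).trans (Nat.pow_sub_le_descFactorial N k)
  · have hδ_ge : 1 ≤ δ := by
      refine le_trans ((one_le_div (by positivity)).2 ?_) hδ
      exact_mod_cast hkN.le.trans (Nat.le_self_pow two_ne_zero k)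
    exact (mul_nonpos_of_nonneg_of_nonpos (by positivity) (by linarith)).trans (by positivity)

theorem sq_one_sub_le_prob_hasUnicycle_mul {n m r : ℕ} {ε δ : ℝ} (hr : Even r) (hr_two : 2 ≤ r)
    (hε : 0 < ε) (hε_le : ε ≤ 1) (hm : (1 + ε) * n ≤ m) (hεr : 2 ≤ ε * (r + 1))
    (hεn : n ≤ (1 + ε) ^ (r + 1)) (hδ : ((r : ℝ) + 1) ^ 2 ≤ δ * (ε * n)) (hδ_le : 4 * δ ≤ 1) :
    (1 - 4 * δ) ^ 2 ≤ prob n 2 0 m (fun F => HasUnicycle (implicationDigraph F)) *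
      (Real.exp (48 * δ) * (1 + 15138 * ((r + 1) * n * δ ^ 2))) := by
  have hr_real : (2 : ℝ) ≤ r := mod_cast hr_two
  have hn_real : 4 * ((r : ℝ) + 1) ^ 2 ≤ n := by
    calc 4 * ((r : ℝ) + 1) ^ 2 ≤ 4 * δ * (ε * n) := by linarith
      _ ≤ 1 * (1 * n) := by gcongr
      _ = n := by ring
  have hn_two : (2 : ℝ) ≤ n := by nlinarith
  have hn_sub_pos : (0 : ℝ) < n - 1 := by linarith
  have hnm : (n : ℝ) ≤ m := by nlinarith
  have : (0 : ℝ) < n := by linarith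
  have hm_pos : (0 : ℝ) < m := by linarith
  have hδ_nonneg : 0 ≤ δ := nonneg_of_mul_nonneg_left ((sq_nonneg _).trans hδ) (by positivity)
  have hsq : 4 * ((r : ℝ) + 1) ^ 2 ≤ 4 * δ * n := by
    have : δ * (ε * n) ≤ δ * (1 * n) := by gcongr
    linarith
  set q : ℝ := 1 / (n * (n - 1)) with hq
  have hq_pos : 0 < q := by positivity
  have hεθ : 1 + ε ≤ n * (m * q) := by
    calc 1 + ε ≤ m / (n - 1) := by rw [le_div_iff₀ hn_sub_pos]; linarith
      _ = n * (m * q) := by rw [hq]; field_simp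
  have hsecond := descFactorial_mul_le_prob_hasUnicycle_mul (m := m) (mod_cast hn_two) hr hr_two hq
    (C := (n * (m * q)) ^ (2 * (r + 1)) / n *
      (Real.exp (48 * δ) * (1 + 15138 * ((r + 1) * n * δ ^ 2)))) (by positivity)
    fun v => sum_prod_pow_transfer_single_le hr v.injective (by positivity) hε hε_le hεθ hεr hεn hδ
  have hvariables : (n : ℝ) ^ (2 * r + 1) * (1 - 4 * δ) ≤ n.descFactorial (2 * r + 1) :=
    pow_mul_one_sub_le_descFactorial (by rify; linarith) (by push_cast; nlinarith)
  have hclauses : (m : ℝ) ^ (2 * (r + 1)) * (1 - 4 * δ) ≤ m.descFactorial (2 * (r + 1)) :=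
    pow_mul_one_sub_le_descFactorial (by rify; linarith) (by push_cast; nlinarith)
  refine le_of_mul_le_mul_left (a := (n * (m * q)) ^ (2 * (r + 1)) / n) ?_ (by positivity)
  calc (n * (m * q)) ^ (2 * (r + 1)) / n * (1 - 4 * δ) ^ 2
      = n ^ (2 * r + 1) * (1 - 4 * δ) * (m ^ (2 * (r + 1)) * (1 - 4 * δ)) * q ^ (2 * (r + 1)) := by
        rw [mul_pow, mul_pow, show 2 * (r + 1) = 2 * r + 1 + 1 by ring, pow_succ (n : ℝ)]
        field_simp
    _ ≤ n.descFactorial (2 * r + 1) * m.descFactorial (2 * (r + 1)) * q ^ (2 * (r + 1)) := by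
        gcongr
    _ ≤ _ := hsecond.trans_eq (by ring)

end Counting

section Asymptotics

variable {ε : ℕ → ℝ} {m : ℕ → ℕ}

/-- The number of variables on one loop of the unicycles that are counted, apart from the common
point. It is even, and large enough for `(1 + ε) ^ (loopLength n ε + 1)` to exceed `n`. -/
noncomputable def loopLength (n : ℕ) (ε : ℝ) : ℕ := 2 * ⌈Real.log n / ε⌉₊ + 2

theorem even_loopLength (n : ℕ) (ε : ℝ) : Even (loopLength n ε) :=
  (even_two_mul _).add even_two

theorem two_mul_log_le_mul_loopLength (n : ℕ) {ε : ℝ} (hε : 0 < ε) :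
    2 * Real.log n ≤ ε * loopLength n ε := by
  have hceil := Nat.le_ceil (Real.log n / ε)
  rw [div_le_iff₀ hε] at hceil
  rw [loopLength]
  push_cast
  linarith

theorem mul_loopLength_add_one_le {n : ℕ} {ε : ℝ} (hε : 0 < ε) (hε_le : ε ≤ 1)
    (hn : 1 ≤ Real.log n) : ε * (loopLength n ε + 1) ≤ 7 * Real.log n := by
  have hceil := (Nat.ceil_lt_add_one (show 0 ≤ Real.log n / ε by positivity)).le
  calc ε * (loopLength n ε + 1) ≤ ε * (2 * (Real.log n / ε + 1) + 2 + 1) := by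
        rw [loopLength]
        push_cast
        gcongr
    _ = 2 * Real.log n + 5 * ε := by field_simp; ring
    _ ≤ 7 * Real.log n := by linarith

theorem le_one_add_pow_loopLength_add_one {n : ℕ} (hn : 0 < n) {ε : ℝ} (hε : 0 < ε)
    (hε_le : ε ≤ 1) : n ≤ (1 + ε) ^ (loopLength n ε + 1) := by
  have hlog : ε / 2 ≤ Real.log (1 + ε) := by
    refine le_trans ?_ (Real.le_log_one_add_of_nonneg hε.le)
    rw [div_le_div_iff₀ two_pos (by positivity)]
    nlinarith
  rw [← Real.log_le_log_iff (by positivity) (by positivity), Real.log_pow]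
  calc Real.log n ≤ loopLength n ε * (ε / 2) := by
        linarith [two_mul_log_le_mul_loopLength n hε]
    _ ≤ (loopLength n ε + 1 : ℕ) * Real.log (1 + ε) := by
        push_cast
        gcongr
        linarith

/-- The relative error, accumulated over one loop, that a given pair of loops of length
`loopLength n ε` causes in the growth of the number of walks. It is denoted by `δ` above. -/
noncomputable def overlapError (n : ℕ) (ε : ℝ) : ℝ := ((loopLength n ε : ℝ) + 1) ^ 2 / (ε * n)

theorem overlapError_nonneg (n : ℕ) {ε : ℝ} (hε : 0 < ε) : 0 ≤ overlapError n ε := by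
  rw [overlapError]; positivity

theorem mul_sq_overlapError_le {n : ℕ} (hn : 1 ≤ Real.log n) {ε : ℝ} (hε : 0 < ε) (hε_le : ε ≤ 1) :
    (loopLength n ε + 1) * n * overlapError n ε ^ 2 ≤
      7 ^ 5 * ((n : ℝ) ^ (-(1 / 7) : ℝ) * Real.log n ^ (5 / 7 : ℝ) / ε) ^ 7 := by
  have : 0 < n := Nat.pos_of_ne_zero (by rintro rfl; norm_num at hn)
  calc (loopLength n ε + 1) * n * overlapError n ε ^ 2
      = (ε * (loopLength n ε + 1)) ^ 5 / (n * ε ^ 7) := by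
        rw [overlapError]
        field_simp
    _ ≤ (7 * Real.log n) ^ 5 / (n * ε ^ 7) := by
        gcongr ?_ ^ 5 / _
        exact mul_loopLength_add_one_le hε hε_le hn
    _ = 7 ^ 5 * ((n : ℝ) ^ (-(1 / 7) : ℝ) * Real.log n ^ (5 / 7 : ℝ) / ε) ^ 7 := by
        rw [div_pow, mul_pow (_ ^ _ : ℝ), ← Real.rpow_mul_natCast n.cast_nonneg,
          ← Real.rpow_mul_natCast (by positivity), show -(1 / 7 : ℝ) * (7 : ℕ) = -1 by norm_num,
          show (5 / 7 : ℝ) * (7 : ℕ) = (5 : ℕ) by norm_num, Real.rpow_neg_one, Real.rpow_natCast]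
        field_simp

theorem eventually_one_le_log : ∀ᶠ n : ℕ in atTop, 1 ≤ Real.log n :=
  (Real.tendsto_log_atTop.comp tendsto_natCast_atTop_atTop).eventually_ge_atTop 1

theorem tendsto_mul_sq_overlapError (hε_pos : ∀ᶠ n in atTop, 0 < ε n)
    (hε_le : ∀ᶠ n in atTop, ε n ≤ 1)
    (hε_large : (fun n : ℕ => (n : ℝ) ^ (-(1 / 7) : ℝ) * Real.log n ^ (5 / 7 : ℝ)) =o[atTop] ε) :
    Tendsto (fun n : ℕ => (loopLength n (ε n) + 1) * n * overlapError n (ε n) ^ 2) atTop (𝓝 0) := by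
  have hlim := (hε_large.tendsto_div_nhds_zero.pow 7).const_mul (7 ^ 5)
  rw [zero_pow (by norm_num), mul_zero] at hlim
  refine squeeze_zero' (.of_forall fun n => by positivity) ?_ hlim
  filter_upwards [eventually_one_le_log, hε_pos, hε_le] with n hn hε hε_le
  exact mul_sq_overlapError_le hn hε hε_le

theorem tendsto_overlapError (hε_pos : ∀ᶠ n in atTop, 0 < ε n)
    (hε_le : ∀ᶠ n in atTop, ε n ≤ 1)
    (hε_large : (fun n : ℕ => (n : ℝ) ^ (-(1 / 7) : ℝ) * Real.log n ^ (5 / 7 : ℝ)) =o[atTop] ε) :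
    Tendsto (fun n : ℕ => overlapError n (ε n)) atTop (𝓝 0) := by
  have hsq : Tendsto (fun n : ℕ => overlapError n (ε n) ^ 2) atTop (𝓝 0) := by
    refine squeeze_zero' (.of_forall fun n => sq_nonneg _) ?_
      (tendsto_mul_sq_overlapError hε_pos hε_le hε_large)
    filter_upwards [eventually_ge_atTop 1] with n hn
    refine le_mul_of_one_le_left (sq_nonneg _) (one_le_mul_of_one_le_of_one_le ?_ (mod_cast hn))
    exact le_add_of_nonneg_left (Nat.cast_nonneg _)
  refine (Real.sqrt_zero ▸ hsq.sqrt).congr' ?_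
  filter_upwards [hε_pos] with n hε
  exact Real.sqrt_sq (overlapError_nonneg n hε)

theorem tendsto_prob_hasUnicycle (hε_pos : ∀ᶠ n in atTop, 0 < ε n)
    (hε_le : ∀ᶠ n in atTop, ε n ≤ 1)
    (hε_large : (fun n : ℕ => (n : ℝ) ^ (-(1 / 7) : ℝ) * Real.log n ^ (5 / 7 : ℝ)) =o[atTop] ε)
    (hm : ∀ᶠ n in atTop, (1 + ε n) * n ≤ m n) :
    Tendsto (fun n : ℕ => prob n 2 0 (m n) fun F => HasUnicycle (implicationDigraph F)) atTop
      (𝓝 1) := by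
  have hδ := tendsto_overlapError hε_pos hε_le hε_large
  have hlim : Tendsto (fun n : ℕ => (1 - 4 * overlapError n (ε n)) ^ 2 /
      (Real.exp (48 * overlapError n (ε n)) *
        (1 + 15138 * ((loopLength n (ε n) + 1) * n * overlapError n (ε n) ^ 2)))) atTop (𝓝 1) := by
    have hnum := ((hδ.const_mul 4).const_sub 1).pow 2
    have hden := (hδ.const_mul 48).rexp.mul
      (((tendsto_mul_sq_overlapError hε_pos hε_le hε_large).const_mul 15138).const_add 1)
    simpa [Pi.div_def] using hnum.div hden (by simp)
  refine tendsto_of_tendsto_of_tendsto_of_le_of_le' hlim tendsto_const_nhds ?_ ?_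
  · filter_upwards [hε_pos, hε_le, hm, eventually_one_le_log, eventually_gt_atTop 0,
      hδ.eventually_le_const (show (0 : ℝ) < 1 / 4 by norm_num)] with n hε hε_le hm hlog hn hδ_le
    refine (div_le_iff₀ (by positivity)).2 ?_
    refine sq_one_sub_le_prob_hasUnicycle_mul (even_loopLength n (ε n)) (Nat.le_add_left _ _) hε
      hε_le hm ?_ (le_one_add_pow_loopLength_add_one hn hε hε_le) ?_ (by linarith)
    · linarith [two_mul_log_le_mul_loopLength n hε]
    · rw [overlapError, div_mul_cancel₀ _ (by positivity)]
  · filter_upwards [eventually_ge_atTop 2] with n hn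
    exact prob_le_one hn 0 _

theorem tendsto_prob_not_satisfiable
    (h : Tendsto (fun n : ℕ => prob n 2 0 (m n) fun F => HasUnicycle (implicationDigraph F)) atTop
      (𝓝 1)) :
    Tendsto (fun n : ℕ => prob n 2 0 (m n) fun F => ¬ F.Satisfiable) atTop (𝓝 1) := by
  refine tendsto_of_tendsto_of_tendsto_of_le_of_le' h tendsto_const_nhds ?_ ?_
  · filter_upwards [eventually_ge_atTop 2] with n hn
    exact prob_mono hn 0 fun _ => HasUnicycle.not_satisfiable
  · filter_upwards [eventually_ge_atTop 2] with n hn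
    exact prob_le_one hn 0 _

theorem isLittleO_min {α E : Type*} [Norm E] {l : Filter α} {f : α → E} {g h : α → ℝ}
    (hg : f =o[l] g) (hh : f =o[l] h) : f =o[l] fun x => min (g x) (h x) := by
  refine isLittleO_iff.2 fun c hc => ?_
  filter_upwards [hg.bound hc, hh.bound hc] with x hgx hhx
  obtain hmin | hmin := min_choice (g x) (h x) <;> rwa [hmin]

theorem isLittleO_rpow_mul_log_rpow_one {s : ℝ} (hs : 0 < s) (t : ℝ) :
    (fun n : ℕ => (n : ℝ) ^ (-s) * Real.log n ^ t) =o[atTop] fun _ => (1 : ℝ) := by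
  rw [isLittleO_one_iff]
  refine ((isLittleO_log_rpow_rpow_atTop t hs).tendsto_div_nhds_zero.comp
    tendsto_natCast_atTop_atTop).congr fun n => ?_
  rw [Real.rpow_neg n.cast_nonneg, ← div_eq_inv_mul, Function.comp_apply]

theorem isBigO_rpow_mul_log_rpow {s s' t t' : ℝ} (hs : s ≤ s') (ht : t ≤ t') :
    (fun n : ℕ => (n : ℝ) ^ s * Real.log n ^ t) =O[atTop]
      fun n : ℕ => (n : ℝ) ^ s' * Real.log n ^ t' := by
  refine IsBigO.of_bound 1 ?_
  filter_upwards [eventually_one_le_log, eventually_ge_atTop 1] with n hlog hn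
  rw [one_mul, Real.norm_of_nonneg (by positivity), Real.norm_of_nonneg (by positivity)]
  gcongr
  exact mod_cast hn

end Asymptotics

end PolarizedSAT

theorem mainTheorem5_general (ε : ℕ → ℝ) (m : ℕ → ℕ) (hε_pos : ∀ᶠ n in atTop, 0 < ε n)
    (hε_large : (fun n : ℕ => (n : ℝ) ^ (-(1 / 7) : ℝ) * Real.log n ^ (5 / 7 : ℝ)) =o[atTop] ε)
    (hm : ∀ᶠ n in atTop, (1 + ε n) * n ≤ m n) :
    Tendsto (fun n : ℕ => PolarizedSAT.prob n 2 0 (m n) fun F =>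
        PolarizedSAT.HasUnicycle (PolarizedSAT.implicationDigraph F)) atTop (𝓝 1) ∧
      Tendsto (fun n : ℕ => PolarizedSAT.prob n 2 0 (m n) fun F => ¬ F.Satisfiable)
        atTop (𝓝 1) := by
  have hunicycle := PolarizedSAT.tendsto_prob_hasUnicycle (m := m)
    (hε_pos.mono fun n hε => lt_min hε one_pos) (.of_forall fun n => min_le_right (ε n) 1)
    (PolarizedSAT.isLittleO_min hε_large
      (PolarizedSAT.isLittleO_rpow_mul_log_rpow_one (by norm_num) _))
    (hm.mono fun n hm => le_trans (by gcongr; exact min_le_left _ _) hm)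
  exact ⟨hunicycle, PolarizedSAT.tendsto_prob_not_satisfiable hunicycle⟩

theorem mainTheorem5 (ε : ℕ → ℝ) (m : ℕ → ℕ)
    (hε_pos : ∀ᶠ n in atTop, 0 < ε n)
    (hε_lt : ∀ᶠ n in atTop, ε n < 1 / 2)
    (hε_large : (fun n : ℕ => (n : ℝ) ^ (-0.1 : ℝ) * Real.log n ^ (0.9 : ℝ)) =o[atTop] ε)
    (hm : ∀ᶠ n in atTop, (1 + ε n) * n < m n) :
    Tendsto (fun n : ℕ => PolarizedSAT.prob n 2 0 (m n) fun F =>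
        PolarizedSAT.HasUnicycle (PolarizedSAT.implicationDigraph F)) atTop (𝓝 1) ∧
      Tendsto (fun n : ℕ => PolarizedSAT.prob n 2 0 (m n) fun F => ¬ F.Satisfiable)
        atTop (𝓝 1) :=
  mainTheorem5_general ε m hε_pos ((PolarizedSAT.isBigO_rpow_mul_log_rpow (by norm_num)
    (by norm_num)).trans_isLittleO hε_large) (hm.mono fun _ => le_of_lt)
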